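/- **Definitions.** Fix an integer $r\ge 1$. A *cell graph of type $(g,n)$* is a connected graph (loops and multiple edges allowed) with $n\ge1$ labeled vertices, drawn as the $1$-skeleton of a cell decomposition of a closed oriented surface of genus $g$; so $n-\#\text{edges}+\#\text{faces}=2-2g$. Let $\mu=(\mu_1,\dots,\mu_n)$ be positive integers and $d=\mu_1+\cdots+\mu_n$. If $r\mid d$, put $s=2g-2+\frac dr+n$. An *edge-labeled arrowed $r$-Hurwitz graph* of type $(g,\mu)$ consists of * a cell graph of type $(g,n)$ with $d/r$ unlabeled faces and with $s$ edges, which are labeled bijectively by $1,\dots,s$; * $d$ dots placed in the corners of the faces, such that each face contains exactly $r$ dots, vertex $i$ has altogether $\mu_i$ dots in the corners around it, and the dots of a face are cyclically ordered by the counterclockwise walk along its boundary; subject to the condition that whenever two sides, lying on edges with labels $\alpha$ and $\beta$, follow each other in this order on the counterclockwise boundary of a face and there is no dot in the corner between them, then $\alpha<\beta$; * for each $i=1,\dots,n$, an arrow attached to one of the $\mu_i$ dots at vertex $i$. (It follows that if an edge bounds the same face twice, then the number $r'$ of dots met on the boundary of this face between its two occurrences satisfies $0<r'<r$.) Isomorphisms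 are induced by orientation-preserving homeomorphisms of the surfaces and preserve the vertex labels, edge labels, dots and arrows. The weighted count of arrowed $r$-Hurwitz graphs is $$\mathcal H^r_{g,n}(\mu_1,\dots,\mu_n)=\frac1{s!}\sum_{[G]}\frac1{|\mathrm{Aut}(G)|},$$ the sum being over the isomorphism classes of edge-labeled arrowed $r$-Hurwitz graphs of type $(g,\mu)$; the factor $1/s!$ accounts for the relabelings of the edges. It does not depend on the order of the $\mu_i$, and it is $0$ if $g<0$ or $r\nmid d$. **Theorem (Edge-Contraction Formula).** For all integers $r\ge1$, $g\ge0$, $n\ge1$ and $\mu_1,\dots,\mu_n\ge1$, with $d=\mu_1+\cdots+\mu_n$, $$ \begin{aligned} \Bigl(2g-2+\frac dr+n\Bigr)\mathcal H^r_{g,n}(\mu_1,\dots,\mu_n) ={}&\sum_{i<j}\mu_i\mu_j\,\mathcal H^r_{g,n-1}(\mu_1,\dots,\mu_{i-1},\mu_i+\mu_j,\mu_{i+1},\dots,\widehat{\mu_j},\dots,\mu_n)\\ &+\frac12\sum_{i=1}^n\mu_i\sum_{\substack{\alpha+\beta=\mu_i\\ \alpha,\beta\ge1}}\Bigl[\mathcal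 H^r_{g-1,n+1}(\alpha,\beta,\mu_1,\dots,\widehat{\mu_i},\dots,\mu_n)\\ &\qquad+\sum_{\substack{g_1+g_2=g\\ I\sqcup J=\{1,\dots,\hat i,\dots,n\}}}\mathcal H^r_{g_1,|I|+1}(\alpha,\mu_I)\,\mathcal H^r_{g_2,|J|+1}(\beta,\mu_J)\Bigr]. \end{aligned} $$ Here $g_1,g_2\ge0$, the pairs $(I,J)$ are ordered, a hat means omission, and $\mu_I=(\mu_k)_{k\in I}$. -/

import Mathlib

namespace Hurwitz

/-- The set underlying the combinatorial description of a cell graph with `d` dots and `s` edges: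
`Sum.inl k` is the `k`-th dot, and `Sum.inr (e, b)` for `b = false, true` are the two half-edges
of the edge `e`. The number `e : Fin s` is the label of the edge. -/
abbrev Dart (d s : ℕ) : Type := Fin d ⊕ (Fin s × Bool)

/-- The involution that exchanges the two half-edges of every edge and fixes every dot. -/
def edgeFlip (d s : ℕ) : Equiv.Perm (Dart d s) :=
  Equiv.sumCongr (Equiv.refl _) (Equiv.prodCongr (Equiv.refl _) Equiv.boolNot)

/-- The label of the edge to which a half-edge belongs; dots carry no label. -/
def edgeLabel {d s : ℕ} : Dart d s → Option (Fin s)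
  | Sum.inl _ => none
  | Sum.inr p => some p.1

/-- The walk around the faces: the dart that follows `x` on the boundary of the face to the left
of `x`, walked counter-clockwise, when `rot` is the counter-clockwise rotation of the half-edges and
dots around each vertex. A half-edge `x` stands here for the side of the face that leaves the vertex
of `x` along `x`; dots are met at the corners of the face. -/
def faceWalk {d s : ℕ} (rot : Equiv.Perm (Dart d s)) : Equiv.Perm (Dart d s) :=
  rot⁻¹ * edgeFlip d s

/-- The number of edges `s = 2 g - 2 + d / r + n` of an `r`-Hurwitz graph of genus `g` whose
vertices are labeled by `V`, with `n = |V|`, `μ v` dots at the vertex `v`, and `d = ∑ μ v`. -/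
def numEdges (r g : ℕ) {V : Type} [Fintype V] (μ : V → ℕ) : ℕ :=
  2 * g + (∑ v, μ v) / r + Fintype.card V - 2

/-- An edge-labeled arrowed `r`-Hurwitz graph of genus `g` whose vertices are labeled by the finite
set `V`, with `μ v` dots at the vertex `v`.

The cell graph and its dots are given by the counter-clockwise rotation `rot` of the half-edges
and dots around each vertex (the dots lying in a corner stand, in their order, between the two
half-edges that bound the corner). The vertices are the cycles of `rot`, the edges are
`Fin (numEdges r g μ)`, the faces are the cycles of `faceWalk rot`, and the cyclic order of the dots
of a face is the one in which `faceWalk rot` meets them. -/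
structure ArrowedGraph (r g : ℕ) {V : Type} [Fintype V] (μ : V → ℕ) where
  /-- the rotation around the vertices -/
  rot : Equiv.Perm (Dart (∑ v, μ v) (numEdges r g μ))
  /-- the label of the vertex at which a half-edge or a dot lies -/
  vert : Dart (∑ v, μ v) (numEdges r g μ) → V
  /-- the arrow: a selected dot for every vertex -/
  arrow : V → Fin (∑ v, μ v)
  /-- two darts lie at the same vertex exactly when they are in the same cycle of the rotation -/
  vert_eq_iff : ∀ x y, vert x = vert y ↔ rot.SameCycle x y
  /-- the arrow of `v` is at a dot of `v`; in particular every `v` is a vertex of the graph -/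
  vert_arrow : ∀ v, vert (Sum.inl (arrow v)) = v
  /-- there are `μ v` dots clustered at the vertex `v` -/
  card_dots : ∀ v, Nat.card {k // vert (Sum.inl k) = v} = μ v
  /-- the graph is connected -/
  connected : ∀ x y, ∃ f ∈ Subgroup.closure {rot, edgeFlip _ _}, f x = y
  /-- the genus is `g`: `#vertices - #edges + #faces = 2 - 2 g` -/
  euler : (Fintype.card V : ℤ) - numEdges r g μ
      + Nat.card (Quotient (Equiv.Perm.SameCycle.setoid (faceWalk rot))) = 2 - 2 * g
  /-- every face has `r` dots -/
  face_dots : ∀ x, Nat.card {k // (faceWalk rot).SameCycle x (Sum.inl k)} = r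
  /-- at a corner of a face without dots, between a side with label `α` and the next side with label
  `β`, one has `α < β` -/
  label_lt : ∀ x, ∀ α ∈ edgeLabel x, ∀ β ∈ edgeLabel (faceWalk rot x), α < β

namespace ArrowedGraph

variable {r g : ℕ} {V : Type} [Fintype V] {μ : V → ℕ}

/-- Isomorphisms of edge-labeled arrowed `r`-Hurwitz graphs: bijections of the half-edges and dots
that preserve edges with their labels (so that dots go to dots), the rotation around the vertices,
the labels of the vertices, and the arrows. -/
structure Iso (G G' : ArrowedGraph r g μ) where
  toPerm : Equiv.Perm (Dart (∑ v, μ v) (numEdges r g μ))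
  edgeLabel_eq : ∀ x, edgeLabel (toPerm x) = edgeLabel x
  map_rot : ∀ x, toPerm (G.rot x) = G'.rot (toPerm x)
  map_vert : ∀ x, G'.vert (toPerm x) = G.vert x
  map_arrow : ∀ v, toPerm (Sum.inl (G.arrow v)) = Sum.inl (G'.arrow v)

/-- The relation of being isomorphic. -/
def isoSetoid (r g : ℕ) {V : Type} [Fintype V] (μ : V → ℕ) : Setoid (ArrowedGraph r g μ) where
  r G G' := Nonempty (Iso G G')
  iseqv :=
    { refl := fun _ => ⟨⟨1, fun _ => rfl, fun _ => rfl, fun _ => rfl, fun _ => rfl⟩⟩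
      symm := by
        rintro G G' ⟨f⟩
        refine ⟨⟨f.toPerm⁻¹, fun x => ?_, fun x => ?_, fun x => ?_, fun v => ?_⟩⟩
        · simpa using (f.edgeLabel_eq (f.toPerm⁻¹ x)).symm
        · rw [Equiv.Perm.inv_eq_iff_eq, f.map_rot]; simp
        · simpa using (f.map_vert (f.toPerm⁻¹ x)).symm
        · rw [Equiv.Perm.inv_eq_iff_eq, f.map_arrow]
      trans := by
        rintro G G' G'' ⟨f⟩ ⟨h⟩
        refine ⟨⟨h.toPerm * f.toPerm, fun x => ?_, fun x => ?_, fun x => ?_, fun v => ?_⟩⟩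
        · simp [h.edgeLabel_eq, f.edgeLabel_eq]
        · simp [h.map_rot, f.map_rot]
        · simp [h.map_vert, f.map_vert]
        · simp [h.map_arrow, f.map_arrow] }

instance : Finite (ArrowedGraph r g μ) :=
  Finite.of_injective
    (fun G : ArrowedGraph r g μ => (G.rot, G.vert, G.arrow)) (by
      rintro ⟨a, b, c, _, _, _, _, _, _, _⟩ ⟨a', b', c', _, _, _, _, _, _, _⟩ h
      simp only [Prod.mk.injEq] at h
      obtain ⟨rfl, rfl, rfl⟩ := h
      rfl)

noncomputable instance : Fintype (Quotient (isoSetoid r g μ)) := Fintype.ofFinite _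

/-- If the edge of a half-edge `x` bounds the same face twice, and `k` steps of the walk
around the face lead from `x` for the first time to the other half-edge of this edge, then the
number `r'` of dots met on the way satisfies `0 < r' < r`. -/
theorem dot_condition (G : ArrowedGraph r g μ) (x : Dart (∑ v, μ v) (numEdges r g μ))
    (hx : edgeLabel x ≠ none) (k : ℕ) (hk : (faceWalk G.rot ^ k) x = edgeFlip _ _ x)
    (hmin : ∀ j < k, (faceWalk G.rot ^ j) x ≠ edgeFlip _ _ x) :
    0 < ((Finset.range k).filter fun j => edgeLabel ((faceWalk G.rot ^ j) x) = none).card ∧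
    ((Finset.range k).filter fun j => edgeLabel ((faceWalk G.rot ^ j) x) = none).card < r := by
  classical
  have hfl : ∀ y : Dart (∑ v, μ v) (numEdges r g μ), edgeLabel (edgeFlip _ _ y) = edgeLabel y := by
    rintro (y | y) <;> rfl
  have hne : edgeFlip _ _ x ≠ x := by
    rcases x with x | ⟨e, b⟩
    · exact absurd rfl hx
    · simp [edgeFlip]
  -- on an arc without dots the labels increase strictly
  have key : ∀ (y : Dart (∑ v, μ v) (numEdges r g μ)) (l : ℕ), 0 < l → edgeLabel y ≠ none →
      edgeLabel ((faceWalk G.rot ^ l) y) = edgeLabel y →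
      ∃ j < l, edgeLabel ((faceWalk G.rot ^ j) y) = none := by
    intro y l hl hy he
    by_contra! hcon
    obtain ⟨a, ha⟩ := Option.ne_none_iff_exists'.1 hy
    have h1 : ∀ m, m < l → ∃ c, edgeLabel ((faceWalk G.rot ^ m) y) = some c ∧ a ≤ c := by
      intro m
      induction m with
      | zero => intro _; exact ⟨a, by simpa using ha, le_rfl⟩
      | succ m ih =>
        intro hm
        obtain ⟨c, hc, hac⟩ := ih (by omega)
        obtain ⟨c', hc'⟩ := Option.ne_none_iff_exists'.1 (hcon (m + 1) (by omega))
        have := G.label_lt _ c hc c' (by rw [← Equiv.Perm.mul_apply, ← pow_succ']; exact hc')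
        exact ⟨c', hc', hac.trans this.le⟩
    obtain ⟨c, hc, hac⟩ := h1 (l - 1) (by omega)
    have := G.label_lt _ c hc a (by
      rw [← Equiv.Perm.mul_apply, ← pow_succ', Nat.sub_add_cancel hl, he, ha]; rfl)
    exact absurd (lt_of_le_of_lt hac this) (lt_irrefl _)
  have hk0 : 0 < k := by
    rcases Nat.eq_zero_or_pos k with rfl | h
    · exact absurd hk.symm (by simpa using hne)
    · exact h
  refine ⟨?_, ?_⟩
  · obtain ⟨j, hj, hj'⟩ := key x k hk0 hx (by rw [hk, hfl])
    exact Finset.card_pos.2 ⟨j, by simp [hj, hj']⟩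
  · -- the period of `x`
    set N := Function.minimalPeriod (faceWalk G.rot) x with hN
    have hper : ∀ n, (faceWalk G.rot ^ n) x = (faceWalk G.rot ^ (n % N)) x := by
      intro n
      rw [Equiv.Perm.coe_pow, Equiv.Perm.coe_pow]
      exact (Function.iterate_mod_minimalPeriod_eq).symm
    have hNpos : 0 < N := Function.minimalPeriod_pos_of_mem_periodicPts
      ((faceWalk G.rot).injective.mem_periodicPts x)
    have hkN : k < N := by
      by_contra! h
      exact hmin (k % N) (lt_of_lt_of_le (Nat.mod_lt _ hNpos) h) (by rw [← hper]; exact hk)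
    have hxN : (faceWalk G.rot ^ N) x = x := by rw [hper]; simp
    obtain ⟨j, hj, hj'⟩ := key (edgeFlip _ _ x) (N - k) (by omega) (by rwa [hfl]) (by
      rw [← hk, ← Equiv.Perm.mul_apply, ← pow_add, Nat.sub_add_cancel hkN.le, hxN, hk, hfl])
    rw [← hk, ← Equiv.Perm.mul_apply, ← pow_add] at hj'
    set S := (Finset.range N).filter fun j => edgeLabel ((faceWalk G.rot ^ j) x) = none with hS
    have hlt : ((Finset.range k).filter
        fun j => edgeLabel ((faceWalk G.rot ^ j) x) = none).card < S.card := by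
      refine Finset.card_lt_card (Finset.ssubset_iff_of_subset ?_ |>.2 ⟨j + k, ?_, ?_⟩)
      · intro i hi
        simp only [Finset.mem_filter, Finset.mem_range, hS] at hi ⊢
        exact ⟨by omega, hi.2⟩
      · simp only [Finset.mem_filter, Finset.mem_range, hS]
        exact ⟨by omega, hj'⟩
      · simp
    refine hlt.trans_le ?_
    have hdot : ∀ i : S, ∃ m : Fin (∑ v, μ v), (faceWalk G.rot ^ (i : ℕ)) x = Sum.inl m := by
      rintro ⟨i, hi⟩
      simp only [Finset.mem_filter, hS] at hi
      rcases h : (faceWalk G.rot ^ i) x with m | p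
      · exact ⟨m, rfl⟩
      · rw [h] at hi; exact absurd hi.2 (by simp [edgeLabel])
    choose m hm using hdot
    have hS' : Nat.card S = S.card := by simp
    rw [← G.face_dots x, ← hS']
    refine Nat.card_le_card_of_injective
      (fun i : S => ⟨m i, ⟨((i : ℕ) : ℤ), by rw [zpow_natCast]; exact hm i⟩⟩) ?_
    rintro ⟨i, hi⟩ ⟨i', hi'⟩ h
    have hmm : m ⟨i, hi⟩ = m ⟨i', hi'⟩ := congrArg Subtype.val h
    have h3 : (faceWalk G.rot ^ i) x = (faceWalk G.rot ^ i') x := by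
      rw [hm ⟨i, hi⟩, hm ⟨i', hi'⟩, hmm]
    rw [Equiv.Perm.coe_pow, Equiv.Perm.coe_pow] at h3
    simp only [Finset.mem_filter, Finset.mem_range, hS] at hi hi'
    exact Subtype.ext (Function.iterate_injOn_Iio_minimalPeriod hi.1 hi'.1 h3)

end ArrowedGraph

/-- The weighted count of arrowed `r`-Hurwitz graphs of genus `g` with `μ v` dots at the
vertex `v`: the sum of `1 / |Aut G|` over the isomorphism classes of edge-labeled arrowed
`r`-Hurwitz graphs, divided by the number `s!` of relabelings of the `s` edges. -/
noncomputable def count (r g : ℕ) {V : Type} [Fintype V] (μ : V → ℕ) : ℚ :=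
  (∑ q : Quotient (ArrowedGraph.isoSetoid r g μ),
      1 / (Nat.card (ArrowedGraph.Iso q.out q.out) : ℚ)) / (Nat.factorial (numEdges r g μ) : ℚ)

/-- The tuple `(μ_1, …, μ_i + μ_j, …, μ_n)` with the entry `μ_j` omitted. -/
def merge {n : ℕ} (μ : Fin n → ℕ) (i j : Fin n) : {k : Fin n // k ≠ j} → ℕ :=
  fun k => if (k : Fin n) = i then μ i + μ j else μ k

/-- The tuple `(α, β, μ_1, …, μ_n)` with the entry `μ_i` omitted. -/
def split {n : ℕ} (μ : Fin n → ℕ) (i : Fin n) (α β : ℕ) : Option (Option {k : Fin n // k ≠ i}) → ℕ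
  | none => α
  | some none => β
  | some (some k) => μ k

/-- The tuple `(α, μ_I)`. -/
def consOn {n : ℕ} (α : ℕ) (μ : Fin n → ℕ) (I : Finset (Fin n)) : Option {k : Fin n // k ∈ I} → ℕ
  | none => α
  | some k => μ k

end Hurwitz

/-! An arrowed Hurwitz graph is a transitive factorization in disguise. Let `σ` be the permutation
of the `d` dots that rotates them around their vertices, and let the edge labeled `e` stand for the
pair of dots behind which its two half-edges are inserted. Since labels must increase across a
corner without dots, the half-edges that follow a dot occur in decreasing order of their labels. The
rotation of all half-edges and dots is therefore recovered by inserting the edges in increasing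
order, each half-edge directly behind its dot. In this description the faces, restricted to dots,
are the cycles of `σ τ₁ ⋯ τ_s` (walked backwards), where `τ_e` is the transposition of the `e`-th
pair. "Each face has `r` dots" means that all cycles of this product have length `r`, and
"connected" means that `σ` and the `τ_e` act transitively.

Let `N` be the number of such sequences of ordered pairs. There are `d! · N` graphs on the fixed set
of darts (`card_arrowedGraph`), and `d! · 2 ^ s` permutations of the darts respect the edge labels.
Orbit counting gives the weighted count `N / (2 ^ s s!)` (`count_eq`).

The edge with the smallest label is contracted by moving the first transposition `(a b)` into `σ`.
If `a` and `b` lie in different cycles, these are joined, and the other pairs form a factorization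
for the merged tuple. If they lie in the same cycle, it is cut. Then the other pairs either still
act transitively, or split into two factorizations on complementary sets of cycles, shuffled
arbitrarily (`numBridged_eq`). This is the recursion `cut_and_join`. The factor `1/2` comes from the
two orderings of the first pair; in the join terms it is absorbed by passing from ordered pairs of
vertices to `i < j`.

The recursion involves the number of edges and not the genus. The Riemann-Hurwitz formula, itself a
consequence of the recursion (`exists_genus`), shows that every nonzero term has a genus in `ℕ`, and
turns sums over numbers of edges into sums over genera (`sum_count_mul_count`). -/

namespace Hurwitz

open Equiv

/-! ### Cycles of permutations, and the insertion of points into cycles -/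

/-- A relation that holds between `c x` and `c (f x)` holds along the cycles of `f`. -/
theorem rel_of_sameCycle {X Y : Type*} {f : Perm X} (S : Setoid Y) (c : X → Y)
    (h : ∀ x, S (c x) (c (f x))) {x y : X} (hxy : f.SameCycle x y) : S (c x) (c y) := by
  obtain ⟨i, rfl⟩ := hxy
  induction i using Int.induction_on with
  | zero => exact S.refl _
  | succ i ih =>
    refine S.trans ih ?_
    rw [add_comm, zpow_add, zpow_one, Perm.mul_apply]
    exact h _
  | pred i ih =>
    refine S.trans ih (S.symm ?_)
    have := h ((f ^ (-(i : ℤ) - 1)) x)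
    rwa [← Perm.mul_apply, ← zpow_one_add, show 1 + (-(i : ℤ) - 1) = -i by ring] at this

theorem sameCycle_of_forall {X : Type*} {f f' : Perm X} (h : ∀ x, f'.SameCycle x (f x)) {x y : X}
    (hxy : f.SameCycle x y) : f'.SameCycle x y :=
  rel_of_sameCycle (Perm.SameCycle.setoid f') id h hxy

theorem sameCycle_apply_self {X : Type*} (f : Perm X) (x : X) : f.SameCycle x (f x) :=
  ⟨1, by simp⟩

section Insert

variable {X : Type*} [DecidableEq X] {F : Perm X} {k h : X}

/-- Multiplying by `swap k h`, where `h` is a fixed point, inserts `h` in front of `k`. -/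
theorem swap_mul_apply_of_fixed (hF : F h = h) : (swap k h * F) h = k := by
  simp [hF]

theorem SameCycle.insert (hF : F h = h) {x y : X}
    (hxy : F.SameCycle x y) : (swap k h * F).SameCycle x y := by
  refine sameCycle_of_forall (fun x => ?_) hxy
  by_cases hx : F x = k
  -- The old step `x ↦ k` becomes the detour `x ↦ h ↦ k`.
  · refine ⟨2, ?_⟩
    rw [hx, zpow_two, Perm.mul_apply, show (swap k h * F) x = h by simp [hx],
      swap_mul_apply_of_fixed hF]
  · by_cases hh : F x = h
    · have : x = h := F.injective (hh.trans hF.symm)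
      rw [this, hF]
    · have : (swap k h * F) x = F x := by
        rw [Perm.mul_apply, swap_apply_of_ne_of_ne hx hh]
      rw [← this]
      exact sameCycle_apply_self _ _

/-- Collapsing `h` onto `k` turns every step of the new permutation into a step of the old one or
into no step at all, so an insertion merges no cycles. -/
theorem sameCycle_insert_iff (hF : F h = h) (hkh : k ≠ h) {x y : X} (hx : x ≠ h) (hy : y ≠ h) :
    (swap k h * F).SameCycle x y ↔ F.SameCycle x y := by
  refine ⟨fun hxy => ?_, SameCycle.insert hF⟩
  have := rel_of_sameCycle (Perm.SameCycle.setoid F) (fun x => if x = h then k else x)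
    (fun x => ?_) hxy
  · simp only [hx, hy, if_false] at this
    exact this
  · change F.SameCycle _ _
    by_cases hxh : x = h
    · subst hxh
      rw [swap_mul_apply_of_fixed hF]
      simp [hkh, Perm.SameCycle.refl]
    · by_cases hk : F x = k
      · simp only [Perm.mul_apply, hk, swap_apply_left, if_true, hxh, if_false]
        rw [← hk]
        exact sameCycle_apply_self _ _
      · have hh : F x ≠ h := fun hh => hxh (F.injective (hh.trans hF.symm))
        simp only [Perm.mul_apply, swap_apply_of_ne_of_ne hk hh, hxh, hh, if_false]
        exact sameCycle_apply_self _ _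

end Insert

/-- `IsInsertion F ρ S` says that `F` arises from the permutation `ρ` of `K` by inserting the
elements of `S` one after the other into its cycles, each in front of an element of `K`. -/
inductive IsInsertion {K H : Type} [DecidableEq K] [DecidableEq H] :
    Perm (K ⊕ H) → Perm K → Set H → Prop
  | base (ρ : Perm K) : IsInsertion (sumCongr ρ (Equiv.refl H)) ρ ∅
  | step {F : Perm (K ⊕ H)} {ρ : Perm K} {S : Set H} (k : K) (h : H) :
      IsInsertion F ρ S → h ∉ S →
      IsInsertion (swap (Sum.inl k) (Sum.inr h) * F) ρ (insert h S)

namespace IsInsertion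

variable {K H : Type} [DecidableEq K] [DecidableEq H] {F : Perm (K ⊕ H)} {ρ : Perm K} {S : Set H}

theorem fixed (hF : IsInsertion F ρ S) {h : H} (hh : h ∉ S) : F (Sum.inr h) = Sum.inr h := by
  induction hF with
  | base ρ => rfl
  | step k h' _ _ ih =>
    rw [Set.mem_insert_iff, not_or] at hh
    rw [Perm.mul_apply, ih hh.2, swap_apply_of_ne_of_ne (by simp) (by simpa using hh.1)]

theorem sameCycle_iff (hF : IsInsertion F ρ S) (k k' : K) :
    F.SameCycle (Sum.inl k) (Sum.inl k') ↔ ρ.SameCycle k k' := by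
  induction hF with
  | base ρ =>
    constructor
    · intro h
      refine rel_of_sameCycle (Perm.SameCycle.setoid ρ)
        (Sum.elim id fun _ => k : K ⊕ H → K) (fun x => ?_) h
      rcases x with x | x
      · exact sameCycle_apply_self ρ x
      · exact Perm.SameCycle.refl _ _
    · exact rel_of_sameCycle (Perm.SameCycle.setoid _) Sum.inl
        (fun x => sameCycle_apply_self (sumCongr ρ (Equiv.refl H)) (Sum.inl x))
  | step k₀ h hF hh ih =>
    rw [← ih, sameCycle_insert_iff (hF.fixed hh) (by simp) (by simp) (by simp)]

theorem exists_sameCycle (hF : IsInsertion F ρ S) {h : H} (hh : h ∈ S) :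
    ∃ k, F.SameCycle (Sum.inr h) (Sum.inl k) := by
  induction hF with
  | base ρ => exact absurd hh (by simp)
  | step k₀ h₀ hF hh₀ ih =>
    rcases hh with rfl | hh
    · exact ⟨k₀, 1, by rw [zpow_one, swap_mul_apply_of_fixed (hF.fixed hh₀)]⟩
    · obtain ⟨k, hk⟩ := ih hh
      exact ⟨k, SameCycle.insert (hF.fixed hh₀) hk⟩

/-- A transposition of two points of `K` can be moved past the insertions: conjugation turns an
insertion in front of `k` into one in front of `swap a b k`. -/
theorem swap_mul (hF : IsInsertion F ρ S) (a b : K) :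
    IsInsertion (swap (Sum.inl a) (Sum.inl b) * F) (swap a b * ρ) S := by
  induction hF with
  | base ρ =>
    have : swap (Sum.inl a) (Sum.inl b) * sumCongr ρ (Equiv.refl H)
        = sumCongr (swap a b * ρ) (Equiv.refl H) := by
      ext x
      rcases x with x | x
      · simp only [Perm.mul_apply, sumCongr_apply, Sum.map_inl]
        exact (Function.Injective.swap_apply Sum.inl_injective a b (ρ x))
      · simp only [Perm.mul_apply, sumCongr_apply, Sum.map_inr]
        exact swap_apply_of_ne_of_ne (by simp) (by simp)
    rw [this]
    exact base _
  | @step F ρ S k h hF hh ih =>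
    have : swap (Sum.inl a) (Sum.inl b) * (swap (Sum.inl k) (Sum.inr h) * F)
        = swap (Sum.inl (swap a b k)) (Sum.inr h) * (swap (Sum.inl a) (Sum.inl b) * F) := by
      rw [← mul_assoc, ← mul_assoc, mul_swap_eq_swap_mul]
      congr 3
      exact Function.Injective.swap_apply Sum.inl_injective a b k
    rw [this]
    exact step _ _ ih hh

end IsInsertion

/-! ### Rotations and face walks obtained by inserting half-edges at dots -/

section Rotation

variable {K E : Type} [DecidableEq K] [DecidableEq E]

/-- The rotation in which the half-edges of the edges of the list are inserted behind their dots,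
beginning with the last edge of the list. -/
def rotOfList (σ : Perm K) (p : E × Bool → K) : List E → Perm (K ⊕ (E × Bool))
  | [] => sumCongr σ (Equiv.refl _)
  | e :: L => rotOfList σ p L
      * swap (Sum.inl (p (e, false))) (Sum.inr (e, false))
      * swap (Sum.inl (p (e, true))) (Sum.inr (e, true))

/-- The exchange of the half-edges of the edges of a list. -/
def flipOfList (K : Type) [DecidableEq K] : List E → Perm (K ⊕ (E × Bool))
  | [] => 1
  | e :: L => swap (Sum.inr (e, false)) (Sum.inr (e, true)) * flipOfList K L

variable {σ : Perm K} {p : E × Bool → K} {L : List E}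

theorem rotOfList_inv_cons (σ : Perm K) (p : E × Bool → K) (e : E) (L : List E) :
    (rotOfList σ p (e :: L))⁻¹ = swap (Sum.inl (p (e, true))) (Sum.inr (e, true)) *
      (swap (Sum.inl (p (e, false))) (Sum.inr (e, false)) * (rotOfList σ p L)⁻¹) := by
  simp [rotOfList, mul_assoc]

theorem rotOfList_congr {p' : E × Bool → K} (h : ∀ e ∈ L, ∀ b, p (e, b) = p' (e, b)) :
    rotOfList σ p L = rotOfList σ p' L := by
  induction L with
  | nil => rfl
  | cons e L ih =>
    simp only [List.mem_cons, forall_eq_or_imp] at h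
    rw [rotOfList, rotOfList, ih h.2, h.1, h.1]

theorem rotOfList_fixed {h : E × Bool} (hh : h.1 ∉ L) :
    rotOfList σ p L (Sum.inr h) = Sum.inr h := by
  induction L with
  | nil => rfl
  | cons e L ih =>
    rw [List.mem_cons, not_or] at hh
    have h1 : ∀ b, h ≠ (e, b) := fun b hb => hh.1 (by rw [hb])
    rw [rotOfList, Perm.mul_apply, Perm.mul_apply,
      swap_apply_of_ne_of_ne (x := Sum.inr h) (by simp) (by simpa using h1 true),
      swap_apply_of_ne_of_ne (by simp) (by simpa using h1 false), ih hh.2]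

theorem rotOfList_inv_fixed {h : E × Bool} (hh : h.1 ∉ L) :
    (rotOfList σ p L)⁻¹ (Sum.inr h) = Sum.inr h := by
  rw [Perm.inv_eq_iff_eq, rotOfList_fixed hh]

theorem isInsertion_rotOfList_inv (hL : L.Nodup) :
    IsInsertion (rotOfList σ p L)⁻¹ σ⁻¹ {h | h.1 ∈ L} := by
  induction L with
  | nil =>
    convert IsInsertion.base (H := E × Bool) σ⁻¹ using 1
    · rfl
    · simp
  | cons e L ih =>
    rw [List.nodup_cons] at hL
    rw [rotOfList_inv_cons]
    convert IsInsertion.step (p (e, true)) (e, true)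
      (IsInsertion.step (p (e, false)) (e, false) (ih hL.2) (by simpa using hL.1)) (by simp [hL.1])
      using 1
    ext ⟨e', b⟩
    cases b <;> simp

theorem rotOfList_sameCycle (hL : L.Nodup) {h : E × Bool} (hh : h.1 ∈ L) :
    (rotOfList σ p L).SameCycle (Sum.inr h) (Sum.inl (p h)) := by
  rw [← Perm.sameCycle_inv]
  induction L with
  | nil => exact absurd hh (by simp)
  | cons e L ih =>
    rw [List.nodup_cons] at hL
    rw [rotOfList_inv_cons]
    have h0 : (rotOfList σ p L)⁻¹ (Sum.inr (e, false)) = Sum.inr (e, false) :=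
      rotOfList_inv_fixed hL.1
    have h1 : (swap (Sum.inl (p (e, false))) (Sum.inr (e, false)) * (rotOfList σ p L)⁻¹)
        (Sum.inr (e, true)) = Sum.inr (e, true) := by
      rw [Perm.mul_apply, rotOfList_inv_fixed hL.1, swap_apply_of_ne_of_ne (by simp) (by simp)]
    rcases List.mem_cons.1 hh with he | hh
    · obtain ⟨e', b⟩ := h
      obtain rfl : e' = e := he
      cases b
      · exact SameCycle.insert h1 ⟨1, by rw [zpow_one, swap_mul_apply_of_fixed h0]⟩
      · exact ⟨1, by rw [zpow_one, swap_mul_apply_of_fixed h1]⟩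
    · exact SameCycle.insert h1 (SameCycle.insert h0 (ih hL.2 hh))

theorem flipOfList_inl (k : K) : flipOfList K L (Sum.inl k) = Sum.inl k := by
  induction L with
  | nil => rfl
  | cons e L ih => rw [flipOfList, Perm.mul_apply, ih, swap_apply_of_ne_of_ne (by simp) (by simp)]

theorem flipOfList_inr (hL : L.Nodup) (e : E) (b : Bool) :
    flipOfList K L (Sum.inr (e, b)) = if e ∈ L then Sum.inr (e, !b) else Sum.inr (e, b) := by
  induction L with
  | nil => rfl
  | cons e' L ih =>
    rw [List.nodup_cons] at hL
    rw [flipOfList, Perm.mul_apply, ih hL.2]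
    by_cases he : e = e'
    · subst he
      simp only [hL.1, if_false, List.mem_cons_self, if_true]
      cases b <;> simp
    · have : ∀ b' b'', (Sum.inr (e, b') : K ⊕ (E × Bool)) ≠ Sum.inr (e', b'') := by simp [he]
      by_cases hm : e ∈ L
      · simp only [hm, if_true, List.mem_cons, or_true]
        exact swap_apply_of_ne_of_ne (this _ _) (this _ _)
      · simp only [hm, if_false, List.mem_cons, he, or_self]
        exact swap_apply_of_ne_of_ne (this _ _) (this _ _)

/-- The walk around the faces is an insertion of the half-edges into the inverse of the product of
the rotation of the dots with the transpositions given by the edges. -/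
theorem isInsertion_faceWalk (hL : L.Nodup) (hp : ∀ e ∈ L, p (e, false) ≠ p (e, true)) :
    IsInsertion ((rotOfList σ p L)⁻¹ * flipOfList K L)
      (σ * (L.reverse.map fun e => swap (p (e, false)) (p (e, true))).prod)⁻¹ {h | h.1 ∈ L} := by
  induction L with
  | nil =>
    convert IsInsertion.base (H := E × Bool) σ⁻¹ using 1 <;> simp [flipOfList, rotOfList]
    rfl
  | cons e L ih =>
    rw [List.nodup_cons] at hL
    have hpe := hp e (by simp)
    -- The side `(e, false)` leads to the other end of the edge, so in the face walk it is inserted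
    -- in front of the dot `p (e, true)`, and vice versa; on the dots alone the new edge acts as a
    -- transposition.
    have key : (rotOfList σ p (e :: L))⁻¹ * flipOfList K (e :: L) =
        swap (Sum.inl (p (e, true))) (Sum.inr (e, false)) *
        (swap (Sum.inl (p (e, false))) (Sum.inr (e, true)) *
        (swap (Sum.inl (p (e, false))) (Sum.inl (p (e, true))) *
        ((rotOfList σ p L)⁻¹ * flipOfList K L))) := by
      have hc : (rotOfList σ p L)⁻¹ * swap (Sum.inr (e, false)) (Sum.inr (e, true)) =
          swap (Sum.inr (e, false)) (Sum.inr (e, true)) * (rotOfList σ p L)⁻¹ := by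
        rw [mul_swap_eq_swap_mul, rotOfList_inv_fixed hL.1, rotOfList_inv_fixed hL.1]
      rw [rotOfList_inv_cons, flipOfList, mul_assoc, mul_assoc,
        ← mul_assoc (rotOfList σ p L)⁻¹ (swap _ _), hc]
      simp only [← mul_assoc]
      congr 2
      have hpe' := hpe.symm
      ext x
      rcases x with x | ⟨e', b⟩
      · by_cases h1 : x = p (e, false)
        · subst h1; simp [swap_apply_def, hpe']
        · by_cases h2 : x = p (e, true)
          · subst h2; simp [swap_apply_def, hpe']
          · simp [swap_apply_def, h1, h2]
      · by_cases he : e' = e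
        · subst he
          cases b <;> simp [swap_apply_def, hpe]
        · simp [swap_apply_def, he]
    rw [key]
    have h3 := (ih hL.2 fun e' he' => hp e' (by simp [he'])).swap_mul (p (e, false)) (p (e, true))
    convert IsInsertion.step (p (e, true)) (e, false)
      (IsInsertion.step (p (e, false)) (e, true) h3 (by simpa using hL.1)) (by simp [hL.1]) using 1
    · simp [mul_assoc]
    · ext ⟨e', b⟩
      cases b <;> simp

/-- Labels decrease along the list and its head is inserted last. Each half-edge is inserted
directly behind its dot, so it pushes those with smaller labels further away. -/
theorem rotOfList_label_lt [LinearOrder E] (hL : L.Pairwise (· > ·)) (hp : ∀ e ∈ L, p (e, false) ≠ p (e, true))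
    {h h' : E × Bool} (hh : h.1 ∈ L) (hr : rotOfList σ p L (Sum.inr h) = Sum.inr h') :
    h'.1 < h.1 := by
  induction L with
  | nil => exact absurd hh (by simp)
  | cons e L ih =>
    rw [List.pairwise_cons] at hL
    have heL : e ∉ L := fun he => lt_irrefl _ (hL.1 e he)
    have hpe := hp e (by simp)
    have hpe' := hpe.symm
    have hlow : ∀ k, rotOfList σ p L (Sum.inl k) = Sum.inr h' → h'.1 < e := by
      intro k hk
      refine hL.1 _ (by_contra fun hn => ?_)
      rw [← rotOfList_fixed (σ := σ) (p := p) hn] at hk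
      exact absurd ((rotOfList σ p L).injective hk) (by simp)
    obtain ⟨e', b⟩ := h
    rw [rotOfList, Perm.mul_apply, Perm.mul_apply] at hr
    by_cases he : e' = e
    · subst he
      refine hlow (p (e', b)) ?_
      rw [← hr]
      cases b <;> simp [swap_apply_def, hpe']
    · rw [swap_apply_of_ne_of_ne (x := Sum.inr (e', b)) (by simp) (by simp [he]),
        swap_apply_of_ne_of_ne (by simp) (by simp [he])] at hr
      exact ih hL.2 (fun e he => hp e (by simp [he])) (by simpa [he] using hh) hr

/-- The half-edges of the head of the list were inserted last, so they directly follow their dots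
and the inverse rotation reveals these dots. Removing the edge allows induction. -/
theorem rotOfList_injective {σ' : Perm K} {p' : E × Bool → K} (hL : L.Nodup)
    (h : rotOfList σ p L = rotOfList σ' p' L)
    (hp : ∀ e ∈ L, p (e, false) ≠ p (e, true)) (hp' : ∀ e ∈ L, p' (e, false) ≠ p' (e, true)) :
    σ = σ' ∧ ∀ e ∈ L, ∀ b, p (e, b) = p' (e, b) := by
  induction L with
  | nil =>
    refine ⟨?_, by simp⟩
    ext k
    have := congrArg (fun f => f (Sum.inl k)) h
    simpa [rotOfList] using this
  | cons e L ih =>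
    rw [List.nodup_cons] at hL
    have hinv : ∀ {σ : Perm K} {p : E × Bool → K}, p (e, false) ≠ p (e, true) → ∀ b,
        (rotOfList σ p (e :: L))⁻¹ (Sum.inr (e, b)) = Sum.inl (p (e, b)) := by
      intro σ p hpe b
      rw [rotOfList_inv_cons, Perm.mul_apply, Perm.mul_apply, rotOfList_inv_fixed hL.1]
      cases b <;> simp [swap_apply_def, hpe]
    have hpp : ∀ b, p (e, b) = p' (e, b) := by
      intro b
      have h1 := hinv (σ := σ) (hp e (by simp)) b
      rw [h, hinv (hp' e (by simp))] at h1
      exact (Sum.inl_injective h1).symm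
    rw [rotOfList, rotOfList, hpp, hpp, mul_left_inj, mul_left_inj] at h
    obtain ⟨h1, h2⟩ := ih hL.2 h (fun e he => hp e (by simp [he])) (fun e he => hp' e (by simp [he]))
    refine ⟨h1, ?_⟩
    simp only [List.mem_cons, forall_eq_or_imp]
    exact ⟨hpp, h2⟩

/-- A half-edge with the greatest label cannot follow another half-edge, so it follows a dot. It can
be taken out of the rotation without creating a forbidden succession, since the half-edges that
remain in the list have unchanged successors. -/
theorem exists_rotOfList [LinearOrder E] [Nonempty K] (hL : L.Pairwise (· > ·)) (rot : Perm (K ⊕ (E × Bool)))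
    (hfix : ∀ h : E × Bool, h.1 ∉ L → rot (Sum.inr h) = Sum.inr h)
    (hlt : ∀ h h' : E × Bool, h.1 ∈ L → rot (Sum.inr h) = Sum.inr h' → h'.1 < h.1) :
    ∃ (σ : Perm K) (p : E × Bool → K), (∀ e ∈ L, p (e, false) ≠ p (e, true)) ∧
      rot = rotOfList σ p L := by
  induction L generalizing rot with
  | nil =>
    have h1 : ∀ k, ∃ k', rot (Sum.inl k) = Sum.inl k' := by
      intro k
      rcases h : rot (Sum.inl k) with k' | h'
      · exact ⟨k', rfl⟩
      · rw [← hfix h' (by simp)] at h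
        exact absurd (rot.injective h) (by simp)
    have h2 : ∀ k, ∃ k', rot⁻¹ (Sum.inl k) = Sum.inl k' := by
      intro k
      rcases h : rot⁻¹ (Sum.inl k) with k' | h'
      · exact ⟨k', rfl⟩
      · rw [Perm.inv_eq_iff_eq, hfix h' (by simp)] at h
        exact absurd h (by simp)
    choose f hf using h1
    choose f' hf' using h2
    refine ⟨⟨f, f', fun k => ?_, fun k => ?_⟩, fun _ => Classical.arbitrary K, by simp, ?_⟩
    · apply Sum.inl_injective (β := E × Bool)
      exact (hf' _).symm.trans (Perm.inv_eq_iff_eq.2 (hf k).symm)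
    · apply Sum.inl_injective (β := E × Bool)
      exact (hf _).symm.trans (Perm.inv_eq_iff_eq.1 (hf' k)).symm
    · ext x
      rcases x with k | h
      · rw [hf]; rfl
      · rw [hfix h (by simp)]; rfl
  | cons e L ih =>
    rw [List.pairwise_cons] at hL
    have heL : e ∉ L := fun he => lt_irrefl _ (hL.1 e he)
    have hk : ∀ b, ∃ k, rot (Sum.inl k) = Sum.inr (e, b) := by
      intro b
      rcases h : rot⁻¹ (Sum.inr (e, b)) with k | h'
      · exact ⟨k, (Perm.inv_eq_iff_eq.1 h).symm⟩
      -- A half-edge in front of one of `e` would carry a label greater than that of `e`, the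
      -- greatest in the list.
      · exfalso
        have h1 : rot (Sum.inr h') = Sum.inr (e, b) := (Perm.inv_eq_iff_eq.1 h).symm
        by_cases hm : h'.1 ∈ e :: L
        · have h2 := hlt _ _ hm h1
          rcases List.mem_cons.1 hm with h3 | h3
          · exact absurd h2 (by simp [h3])
          · exact lt_asymm h2 (hL.1 _ h3)
        · rw [hfix h' hm] at h1
          exact hm (by simp [Sum.inr_injective h1])
    choose k hk using hk
    have hkk : k false ≠ k true := by
      intro h
      have := (hk false).symm.trans (h ▸ hk true)
      simp at this
    set rot₀ := rot * swap (Sum.inl (k true)) (Sum.inr (e, true))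
      * swap (Sum.inl (k false)) (Sum.inr (e, false)) with hrot₀
    have hother : ∀ h : E × Bool, h.1 ≠ e → rot₀ (Sum.inr h) = rot (Sum.inr h) := by
      rintro ⟨e', b⟩ he
      rw [hrot₀, Perm.mul_apply, Perm.mul_apply,
        swap_apply_of_ne_of_ne (x := Sum.inr (e', b)) (by simp) (by simpa using fun h => absurd h he),
        swap_apply_of_ne_of_ne (by simp) (by simpa using fun h => absurd h he)]
    have he : ∀ b, rot₀ (Sum.inr (e, b)) = Sum.inr (e, b) := by
      intro b
      rw [hrot₀, Perm.mul_apply, Perm.mul_apply]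
      cases b
      · rw [swap_apply_right, swap_apply_of_ne_of_ne (by simpa using hkk) (by simp), hk]
      · rw [swap_apply_of_ne_of_ne (x := Sum.inr (e, true)) (by simp) (by simp), swap_apply_right, hk]
    have hfix₀ : ∀ h : E × Bool, h.1 ∉ L → rot₀ (Sum.inr h) = Sum.inr h := by
      rintro ⟨e', b⟩ hh
      by_cases h1 : e' = e
      · subst h1
        exact he b
      · rw [hother _ h1]
        exact hfix _ (by simpa [h1] using hh)
    have hlt₀ : ∀ h h' : E × Bool, h.1 ∈ L → rot₀ (Sum.inr h) = Sum.inr h' → h'.1 < h.1 := by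
      intro h h' hh hr
      have h1 : h.1 ≠ e := fun h1 => heL (h1 ▸ hh)
      rw [hother h h1] at hr
      exact hlt h h' (by simp [hh]) hr
    obtain ⟨σ, p, hp, hσ⟩ := ih hL.2 rot₀ hfix₀ hlt₀
    refine ⟨σ, fun h => if h.1 = e then k h.2 else p h, ?_, ?_⟩
    · simp only [List.mem_cons, forall_eq_or_imp, if_true]
      refine ⟨hkk, fun e' he' => ?_⟩
      have : e' ≠ e := fun h => heL (h ▸ he')
      simpa [this] using hp e' he'
    · rw [rotOfList, rotOfList_congr (p' := p), ← hσ, hrot₀]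
      · simp [mul_assoc]
      · intro e' he' b
        have : e' ≠ e := fun h => heL (h ▸ he')
        simp [this]

end Rotation

/-! ### Transitive factorizations into transpositions and their transport along bijections -/

section Factorization

variable {X Y : Type}

/-- Every set that is invariant under `σ` and under the transpositions of the pairs in `l` is empty
or everything. -/
def JointlyTransitive (σ : Perm X) (l : List (X × X)) : Prop :=
  ∀ A : Set X, (∀ x, σ x ∈ A ↔ x ∈ A) → (∀ p ∈ l, p.1 ∈ A ↔ p.2 ∈ A) → ∀ x ∈ A, ∀ y, y ∈ A

/-- The product of `σ` with the transpositions of the pairs in `l`. -/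
def mulSwaps [DecidableEq X] (σ : Perm X) (l : List (X × X)) : Perm X :=
  σ * (l.map fun p => swap p.1 p.2).prod

/-- All cycles of `π`, including the fixed points, have `r` elements. -/
def CyclesHaveCard (r : ℕ) (π : Perm X) : Prop :=
  ∀ x, Nat.card {k // π.SameCycle x k} = r

/-- The transpositions of the pairs in `l` act transitively together with `σ` and take `σ` to a
permutation with all cycles of length `r`. -/
structure IsFactorization [DecidableEq X] (r : ℕ) (σ : Perm X) (l : List (X × X)) : Prop where
  ne : ∀ p ∈ l, p.1 ≠ p.2
  trans : JointlyTransitive σ l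
  cycles : CyclesHaveCard r (mulSwaps σ l)

/-- The number of sequences of `s` ordered pairs that are factorizations of `σ`. -/
noncomputable def numFactorizations [DecidableEq X] (r : ℕ) (σ : Perm X) (s : ℕ) : ℕ :=
  Nat.card {w : Fin s → X × X // IsFactorization r σ (List.ofFn w)}

theorem mulSwaps_cons [DecidableEq X] (σ : Perm X) (p : X × X) (l : List (X × X)) :
    mulSwaps σ (p :: l) = mulSwaps (σ * swap p.1 p.2) l := by
  simp [mulSwaps, mul_assoc]

theorem sameCycle_semiconj {σ : Perm X} {τ : Perm Y} {f : X → Y} (hf : Function.Semiconj f σ τ)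
    {x y : X} (h : σ.SameCycle x y) : τ.SameCycle (f x) (f y) :=
  rel_of_sameCycle (Perm.SameCycle.setoid τ) f
    (fun x => by rw [hf x]; exact sameCycle_apply_self τ (f x)) h

theorem semiconj_symm {σ : Perm X} {τ : Perm Y} {e : X ≃ Y} (he : Function.Semiconj e σ τ) :
    Function.Semiconj e.symm τ σ := by
  intro y
  rw [symm_apply_eq, he, apply_symm_apply]

theorem sameCycle_semiconj_iff {σ : Perm X} {τ : Perm Y} {e : X ≃ Y}
    (he : Function.Semiconj e σ τ) {x y : X} : τ.SameCycle (e x) (e y) ↔ σ.SameCycle x y :=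
  ⟨fun h => by simpa using sameCycle_semiconj (semiconj_symm he) h, sameCycle_semiconj he⟩

theorem CyclesHaveCard.semiconj {σ : Perm X} {τ : Perm Y} {e : X ≃ Y}
    (he : Function.Semiconj e σ τ) {r : ℕ} (h : CyclesHaveCard r σ) : CyclesHaveCard r τ := by
  intro y
  rw [← h (e.symm y)]
  exact (Nat.card_congr (e.subtypeEquiv fun x => by
    rw [← sameCycle_semiconj_iff he, apply_symm_apply])).symm

theorem JointlyTransitive.semiconj {σ : Perm X} {τ : Perm Y} {e : X ≃ Y}
    (he : Function.Semiconj e σ τ) {l : List (X × X)} (h : JointlyTransitive σ l) :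
    JointlyTransitive τ (l.map (Prod.map e e)) := by
  intro A hA hl x hx y
  have := h (e ⁻¹' A) (fun x => by simp [he x, hA]) (fun p hp => hl _ (List.mem_map_of_mem hp))
    (e.symm x) (by simpa using hx) (e.symm y)
  simpa using this

variable [DecidableEq X] [DecidableEq Y]

theorem semiconj_mul_swap {σ : Perm X} {τ : Perm Y} {f : X → Y} (hinj : Function.Injective f)
    (hf : Function.Semiconj f σ τ) (a b : X) :
    Function.Semiconj f (σ * swap a b) (τ * swap (f a) (f b)) := by
  intro x
  rw [Perm.mul_apply, Perm.mul_apply, hf, hinj.swap_apply]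

theorem semiconj_mulSwaps {σ : Perm X} {τ : Perm Y} {f : X → Y} (hinj : Function.Injective f)
    (hf : Function.Semiconj f σ τ) (l : List (X × X)) :
    Function.Semiconj f (mulSwaps σ l) (mulSwaps τ (l.map (Prod.map f f))) := by
  induction l generalizing σ τ with
  | nil => simpa [mulSwaps] using hf
  | cons p l ih =>
    rw [mulSwaps_cons, List.map_cons, mulSwaps_cons]
    exact ih (semiconj_mul_swap hinj hf _ _)

theorem IsFactorization.semiconj {σ : Perm X} {τ : Perm Y} {e : X ≃ Y}
    (he : Function.Semiconj e σ τ) {r : ℕ} {l : List (X × X)} (h : IsFactorization r σ l) :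
    IsFactorization r τ (l.map (Prod.map e e)) where
  ne := by
    intro p hp
    obtain ⟨q, hq, rfl⟩ := List.mem_map.1 hp
    simpa using h.ne q hq
  trans := h.trans.semiconj he
  cycles := h.cycles.semiconj (semiconj_mulSwaps e.injective he l)

theorem isFactorization_semiconj_iff {σ : Perm X} {τ : Perm Y} {e : X ≃ Y}
    (he : Function.Semiconj e σ τ) {r : ℕ} {l : List (X × X)} :
    IsFactorization r τ (l.map (Prod.map e e)) ↔ IsFactorization r σ l := by
  refine ⟨fun h => ?_, IsFactorization.semiconj he⟩
  simpa [Function.comp_def, Prod.map] using h.semiconj (semiconj_symm he)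

theorem numFactorizations_semiconj {σ : Perm X} {τ : Perm Y} {e : X ≃ Y}
    (he : Function.Semiconj e σ τ) (r s : ℕ) :
    numFactorizations r σ s = numFactorizations r τ s := by
  refine Nat.card_congr ((Equiv.piCongrRight fun _ : Fin s => prodCongr e e).subtypeEquiv
    fun w => ?_)
  rw [← isFactorization_semiconj_iff he, List.map_ofFn]
  rfl

end Factorization

/-! ### The standard permutation with labeled and marked cycles -/

section StdPerm

variable {V : Type} {μ : V → ℕ}

/-- The permutation with one cycle of length `μ v` for every `v`. -/
def stdPerm (μ : V → ℕ) : Perm (Σ v, Fin (μ v)) :=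
  sigmaCongrRight fun v => finRotate (μ v)

theorem finRotate_pow_zero {n : ℕ} (h : 0 < n) (k : ℕ) (hk : k < n) :
    (finRotate n ^ k) ⟨0, h⟩ = ⟨k, hk⟩ := by
  induction k with
  | zero => rfl
  | succ k ih =>
    rw [pow_succ', Perm.mul_apply, ih (by omega)]
    obtain ⟨m, rfl⟩ : ∃ m, n = m + 1 := ⟨n - 1, by omega⟩
    exact finRotate_of_lt (by omega)

theorem stdPerm_pow_apply (v : V) (j : Fin (μ v)) (k : ℕ) :
    (stdPerm μ ^ k) ⟨v, j⟩ = ⟨v, (finRotate (μ v) ^ k) j⟩ := by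
  induction k with
  | zero => rfl
  | succ k ih => rw [pow_succ', Perm.mul_apply, ih, pow_succ', Perm.mul_apply]; rfl

theorem stdPerm_pow_zero (v : V) (j : Fin (μ v)) :
    (stdPerm μ ^ (j : ℕ)) ⟨v, ⟨0, j.pos⟩⟩ = ⟨v, j⟩ := by
  rw [stdPerm_pow_apply, finRotate_pow_zero j.pos j j.2]

theorem stdPerm_sameCycle_iff {x y : Σ v, Fin (μ v)} :
    (stdPerm μ).SameCycle x y ↔ x.1 = y.1 := by
  constructor
  · exact rel_of_sameCycle (Setoid.ker (Sigma.fst : (Σ v, Fin (μ v)) → V)) id (fun x => rfl)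
  · have h : ∀ x : Σ v, Fin (μ v), (stdPerm μ).SameCycle ⟨x.1, ⟨0, x.2.pos⟩⟩ x :=
      fun x => ⟨(x.2 : ℕ), by rw [zpow_natCast]; exact stdPerm_pow_zero x.1 x.2⟩
    obtain ⟨v, i⟩ := x
    obtain ⟨v', j⟩ := y
    rintro rfl
    exact (h ⟨v, i⟩).symm.trans (h ⟨v, j⟩)

theorem semiconj_pow {X Y : Type} {σ : Perm X} {τ : Perm Y} {f : X → Y}
    (hf : Function.Semiconj f σ τ) (k : ℕ) (x : X) : f ((σ ^ k) x) = (τ ^ k) (f x) := by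
  rw [Perm.coe_pow, Perm.coe_pow]
  exact (hf.iterate_right k) x

/-- Every dot is reached from the zeroth dot of its cycle, so an intertwining map is determined by
the images of the marked points. This is the rigidity that the arrows provide. -/
theorem semiconj_stdPerm_eq {X : Type} {σ : Perm X} {f f' : (Σ v, Fin (μ v)) → X}
    (hf : Function.Semiconj f (stdPerm μ) σ) (hf' : Function.Semiconj f' (stdPerm μ) σ)
    (h : ∀ v (hv : 0 < μ v), f ⟨v, ⟨0, hv⟩⟩ = f' ⟨v, ⟨0, hv⟩⟩) : f = f' := by
  ext ⟨v, j⟩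
  rw [← stdPerm_pow_zero v j, semiconj_pow hf, semiconj_pow hf', h]

/-- A permutation with a marked point in each of its labeled cycles is the standard one. -/
theorem exists_semiconj_stdPerm {X : Type} [Finite X] {σ : Perm X} {vert : X → V} {arrow : V → X}
    (hiff : ∀ x y, vert x = vert y ↔ σ.SameCycle x y) (harrow : ∀ v, vert (arrow v) = v)
    (hcard : ∀ v, Nat.card {x // vert x = v} = μ v) :
    ∃ e : (Σ v, Fin (μ v)) ≃ X, Function.Semiconj e (stdPerm μ) σ ∧
      (∀ v (hv : 0 < μ v), e ⟨v, ⟨0, hv⟩⟩ = arrow v) ∧ ∀ x, vert (e x) = x.1 := by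
  have hvert : ∀ v (k : ℕ), vert ((σ ^ k) (arrow v)) = v := by
    intro v k
    nth_rewrite 2 [← harrow v]
    rw [hiff]
    exact Perm.SameCycle.symm ⟨k, by simp⟩
  have hpos : ∀ v, 0 < Function.minimalPeriod σ (arrow v) := fun v =>
    Function.minimalPeriod_pos_of_mem_periodicPts (σ.injective.mem_periodicPts _)
  have hmod : ∀ v (k : ℕ), (σ ^ (k % Function.minimalPeriod σ (arrow v))) (arrow v)
      = (σ ^ k) (arrow v) := by
    intro v k
    rw [Perm.coe_pow, Perm.coe_pow]
    exact Function.iterate_mod_minimalPeriod_eq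
  have hsurj : ∀ x, ∃ k < Function.minimalPeriod σ (arrow (vert x)),
      (σ ^ k) (arrow (vert x)) = x := by
    intro x
    obtain ⟨k, hk⟩ := ((hiff (arrow (vert x)) x).1 (harrow _)).exists_nat_pow_eq
    exact ⟨k % _, Nat.mod_lt _ (hpos _), by rw [hmod, hk]⟩
  -- The orbit of the marked point is the whole fibre of `vert`, so its period is the number of
  -- points in the fibre.
  have hper : ∀ v, Function.minimalPeriod σ (arrow v) = μ v := by
    intro v
    rw [← hcard v, ← Nat.card_fin (Function.minimalPeriod σ (arrow v))]
    refine Nat.card_eq_of_bijective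
      (fun k : Fin _ => (⟨(σ ^ (k : ℕ)) (arrow v), hvert v k⟩ : {x // vert x = v})) ⟨?_, ?_⟩
    · rintro ⟨k, hk⟩ ⟨k', hk'⟩ h
      have h := congrArg Subtype.val h
      simp only [Perm.coe_pow] at h
      exact Fin.ext (Function.iterate_injOn_Iio_minimalPeriod hk hk' h)
    · rintro ⟨x, rfl⟩
      obtain ⟨k, hk, h⟩ := hsurj x
      exact ⟨⟨k, hk⟩, Subtype.ext h⟩
  let f : (Σ v, Fin (μ v)) → X := fun x => (σ ^ (x.2 : ℕ)) (arrow x.1)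
  have hf : Function.Bijective f := by
    constructor
    · rintro ⟨v, j⟩ ⟨v', j'⟩ h
      obtain rfl : v = v' := by
        have := congrArg vert h
        simpa only [f, hvert] using this
      simp only [f, Perm.coe_pow] at h
      have : (j : ℕ) = j' := Function.iterate_injOn_Iio_minimalPeriod
        (by rw [Set.mem_Iio, hper]; exact j.2) (by rw [Set.mem_Iio, hper]; exact j'.2) h
      rw [Fin.ext this]
    · intro x
      obtain ⟨k, hk, h⟩ := hsurj x
      rw [hper] at hk
      exact ⟨⟨vert x, ⟨k, hk⟩⟩, h⟩
  refine ⟨Equiv.ofBijective f hf, ?_, fun v hv => rfl, fun x => hvert _ _⟩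
  rintro ⟨v, j⟩
  change (σ ^ (finRotate (μ v) j : ℕ)) (arrow v) = σ ((σ ^ (j : ℕ)) (arrow v))
  have : (finRotate (μ v) j : ℕ) = (j + 1) % μ v := by
    have := j.neZero
    rw [finRotate_apply, Fin.val_add]
    simp
  have h := hmod v (j + 1)
  rw [hper] at h
  rw [this, h, pow_succ', Perm.mul_apply]

end StdPerm

/-! ### The graph of a factorization: vertices, faces, connectedness -/

section Rotation

variable {d s : ℕ}

/-- The ends of the edges, as a function on half-edges. -/
def halfEdgeDot {K : Type} (w : Fin s → K × K) : Fin s × Bool → K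
  | (e, false) => (w e).1
  | (e, true) => (w e).2

/-- The rotation of half-edges and dots that is given by the rotation `σ` of the dots
and the edges with ends `w`. -/
def graphRot (σ : Perm (Fin d)) (w : Fin s → Fin d × Fin d) : Perm (Dart d s) :=
  rotOfList σ (halfEdgeDot w) (List.finRange s).reverse

/-- The dot behind which a half-edge is inserted. -/
def dartDot (w : Fin s → Fin d × Fin d) : Dart d s → Fin d :=
  Sum.elim id (halfEdgeDot w)

variable {σ : Perm (Fin d)} {w : Fin s → Fin d × Fin d}

theorem pairwise_finRange_reverse : (List.finRange s).reverse.Pairwise (· > ·) := by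
  rw [List.pairwise_reverse]
  exact List.pairwise_lt_finRange s

theorem nodup_finRange_reverse : (List.finRange s).reverse.Nodup :=
  List.nodup_reverse.2 (List.nodup_finRange s)

theorem mem_finRange_reverse (e : Fin s) : e ∈ (List.finRange s).reverse := by simp

theorem halfEdgeDot_ne (hw : ∀ p ∈ List.ofFn w, p.1 ≠ p.2) (e : Fin s) :
    halfEdgeDot w (e, false) ≠ halfEdgeDot w (e, true) :=
  hw _ (List.mem_ofFn.2 ⟨e, rfl⟩)

theorem flipOfList_eq_edgeFlip :
    flipOfList (Fin d) (List.finRange s).reverse = edgeFlip d s := by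
  ext1 x
  rcases x with k | ⟨e, b⟩
  · rw [flipOfList_inl]; rfl
  · rw [flipOfList_inr nodup_finRange_reverse, if_pos (mem_finRange_reverse e)]; rfl

theorem graphRot_sameCycle_dartDot (x : Dart d s) :
    (graphRot σ w).SameCycle x (Sum.inl (dartDot w x)) := by
  rcases x with k | h
  · exact Perm.SameCycle.refl _ _
  · exact rotOfList_sameCycle nodup_finRange_reverse (mem_finRange_reverse _)

theorem graphRot_sameCycle_iff (x y : Dart d s) :
    (graphRot σ w).SameCycle x y ↔ σ.SameCycle (dartDot w x) (dartDot w y) := by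
  have h := (isInsertion_rotOfList_inv (σ := σ) (p := halfEdgeDot w)
    (nodup_finRange_reverse (s := s))).sameCycle_iff (dartDot w x) (dartDot w y)
  rw [Perm.sameCycle_inv, Perm.sameCycle_inv] at h
  rw [← h]
  exact ⟨fun hxy => (graphRot_sameCycle_dartDot x).symm.trans
      (hxy.trans (graphRot_sameCycle_dartDot y)),
    fun hxy => (graphRot_sameCycle_dartDot x).trans
      (hxy.trans (graphRot_sameCycle_dartDot y).symm)⟩

theorem graphRot_label_lt (hw : ∀ p ∈ List.ofFn w, p.1 ≠ p.2) (x : Dart d s) :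
    ∀ α ∈ edgeLabel x, ∀ β ∈ edgeLabel (faceWalk (graphRot σ w) x), α < β := by
  intro α hα β hβ
  rcases x with k | ⟨e, b⟩
  · simp [edgeLabel] at hα
  · rcases h : faceWalk (graphRot σ w) (Sum.inr (e, b)) with k | h'
    · rw [h] at hβ; simp [edgeLabel] at hβ
    · rw [h] at hβ
      simp only [edgeLabel, Option.mem_some_iff] at hα hβ
      subst hα hβ
      rw [faceWalk, Perm.mul_apply, Perm.inv_eq_iff_eq] at h
      exact rotOfList_label_lt (h' := (e, !b)) pairwise_finRange_reverse
        (fun e _ => halfEdgeDot_ne hw e) (mem_finRange_reverse _) h.symm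

theorem isInsertion_faceWalk_graphRot (hw : ∀ p ∈ List.ofFn w, p.1 ≠ p.2) :
    IsInsertion (faceWalk (graphRot σ w)) (mulSwaps σ (List.ofFn w))⁻¹ Set.univ := by
  have h := isInsertion_faceWalk (σ := σ) nodup_finRange_reverse
    (fun e (_ : e ∈ (List.finRange s).reverse) => halfEdgeDot_ne hw e)
  rw [flipOfList_eq_edgeFlip, List.reverse_reverse] at h
  have hu : (Set.univ : Set (Fin s × Bool)) = {h | h.1 ∈ List.finRange s} := by
    ext h
    simp
  have hm : mulSwaps σ (List.ofFn w) = σ * ((List.finRange s).map fun e =>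
      swap (halfEdgeDot w (e, false)) (halfEdgeDot w (e, true))).prod := by
    unfold mulSwaps
    rw [List.ofFn_eq_map, List.map_map]
    rfl
  rw [hm, hu]
  simp only [List.mem_reverse] at h
  exact h

/-- Every half-edge was inserted in front of a dot, so every face contains a dot and it suffices to
count from dots; there the face walk induces the inverse of the product. -/
theorem graphRot_face_dots_iff (hw : ∀ p ∈ List.ofFn w, p.1 ≠ p.2) (r : ℕ) :
    (∀ x, Nat.card {k // (faceWalk (graphRot σ w)).SameCycle x (Sum.inl k)} = r) ↔
      CyclesHaveCard r (mulSwaps σ (List.ofFn w)) := by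
  have hI := isInsertion_faceWalk_graphRot (σ := σ) hw
  have key : ∀ k : Fin d,
      Nat.card {k' // (faceWalk (graphRot σ w)).SameCycle (Sum.inl k) (Sum.inl k')} =
      Nat.card {k' // (mulSwaps σ (List.ofFn w)).SameCycle k k'} := fun k => by
    refine Nat.card_congr (Equiv.subtypeEquivRight fun k' => ?_)
    rw [hI.sameCycle_iff, Perm.sameCycle_inv]
  constructor
  · intro h k
    rw [← key, h]
  · intro h x
    obtain ⟨k, hk⟩ : ∃ k, (faceWalk (graphRot σ w)).SameCycle x (Sum.inl k) := by
      rcases x with k | h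
      · exact ⟨k, Perm.SameCycle.refl _ _⟩
      · exact hI.exists_sameCycle (Set.mem_univ h)
    rw [← h k, ← key]
    exact Nat.card_congr (Equiv.subtypeEquivRight fun k' =>
      ⟨fun h => hk.symm.trans h, fun h => hk.trans h⟩)

/-- Each half-edge lies in the vertex cycle of its dot. A set of dots invariant under `σ` and the
pairs thus pulls back to a set of darts invariant under rotation and flip; conversely, the dots
reachable from a dart form such a set of dots. -/
theorem graphRot_connected_iff :
    (∀ x y, ∃ f ∈ Subgroup.closure {graphRot σ w, edgeFlip d s}, f x = y) ↔
      JointlyTransitive σ (List.ofFn w) := by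
  constructor
  · intro h A hA hl x hx y
    have hAc : ∀ {k k'}, σ.SameCycle k k' → (k ∈ A ↔ k' ∈ A) := fun hk =>
      iff_of_eq (rel_of_sameCycle (Setoid.ker (· ∈ A)) id (fun x => propext (hA x).symm) hk)
    obtain ⟨f, hf, hfx⟩ := h (Sum.inl x) (Sum.inl y)
    have hinv : ∀ z, dartDot w (f z) ∈ A ↔ dartDot w z ∈ A := by
      clear hfx
      induction hf using Subgroup.closure_induction with
      | mem f hf =>
        rcases hf with rfl | rfl
        · intro z
          exact hAc ((graphRot_sameCycle_iff _ _).1 (sameCycle_apply_self _ z).symm)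
        · rintro (z | ⟨e, b⟩)
          · rfl
          · have := hl (w e) (List.mem_ofFn.2 ⟨e, rfl⟩)
            cases b
            · exact this.symm
            · exact this
      | one => intro z; rfl
      | mul f g _ _ hf hg => intro z; rw [Perm.mul_apply, hf, hg]
      | inv f _ hf =>
        intro z
        rw [← hf]
        simp
    have := hinv (Sum.inl x)
    rw [hfx] at this
    exact this.2 hx
  · intro h x y
    set C := Subgroup.closure {graphRot σ w, edgeFlip d s} with hC
    have hrot : graphRot σ w ∈ C := Subgroup.subset_closure (by simp)
    have hflip : edgeFlip d s ∈ C := Subgroup.subset_closure (by simp)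
    have htrans : ∀ {a b c : Dart d s}, (∃ f ∈ C, f a = b) → (∃ f ∈ C, f b = c) →
        ∃ f ∈ C, f a = c := by
      rintro a b c ⟨f, hf, rfl⟩ ⟨f', hf', rfl⟩
      exact ⟨f' * f, C.mul_mem hf' hf, rfl⟩
    have hcyc : ∀ {a b : Dart d s}, (graphRot σ w).SameCycle a b → ∃ f ∈ C, f a = b := by
      rintro a b ⟨i, hi⟩
      exact ⟨_, C.zpow_mem hrot i, hi⟩
    have hpair : ∀ e b, ∃ f ∈ C, f (Sum.inl (halfEdgeDot w (e, b)))
        = Sum.inl (halfEdgeDot w (e, !b)) := fun e b =>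
      htrans (hcyc (graphRot_sameCycle_dartDot (Sum.inr (e, b))).symm)
        (htrans (b := Sum.inr (e, !b)) ⟨_, hflip, rfl⟩
          (hcyc (graphRot_sameCycle_dartDot (Sum.inr (e, !b)))))
    have hmem := h {k | ∃ f ∈ C, f x = Sum.inl k} (fun k => ?_) (fun p hp => ?_)
      (dartDot w x) (hcyc (graphRot_sameCycle_dartDot x)) (dartDot w y)
    · exact htrans hmem (hcyc (graphRot_sameCycle_dartDot y).symm)
    · have hk : (graphRot σ w).SameCycle (Sum.inl k) (Sum.inl (σ k)) :=
        (graphRot_sameCycle_iff _ _).2 (sameCycle_apply_self σ k)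
      exact ⟨fun h => htrans h (hcyc hk.symm), fun h => htrans h (hcyc hk)⟩
    · obtain ⟨e, rfl⟩ := List.mem_ofFn.1 hp
      exact ⟨fun h => htrans h (hpair e false), fun h => htrans h (hpair e true)⟩

end Rotation

/-! ### Graphs on a fixed set of darts correspond to parametrized factorizations -/

theorem card_eq_card_quotient_mul {K Q : Type} [Finite K] [Finite Q] (f : K → Q) (r : ℕ)
    (h : ∀ q, Nat.card {k // f k = q} = r) : Nat.card K = Nat.card Q * r := by
  have := Fintype.ofFinite Q
  rw [← Nat.card_congr (Equiv.sigmaFiberEquiv f), Nat.card_sigma]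
  simp [h]

theorem CyclesHaveCard.dvd {X : Type} [Finite X] {r : ℕ} {π : Perm X}
    (h : CyclesHaveCard r π) : r ∣ Nat.card X := by
  refine ⟨_, (card_eq_card_quotient_mul (Quotient.mk (Perm.SameCycle.setoid π)) r
    fun q => ?_).trans (mul_comm _ _)⟩
  induction q using Quotient.inductionOn with
  | h x =>
    rw [← h x]
    refine Nat.card_congr (Equiv.subtypeEquivRight fun k => ?_)
    rw [Quotient.eq]
    exact ⟨fun h => Perm.SameCycle.symm h, fun h => Perm.SameCycle.symm h⟩

section Graph

variable {r g : ℕ} {V : Type} [Fintype V] {μ : V → ℕ}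

/-- The data that determine an arrowed Hurwitz graph: a parametrization of the dots
by the standard permutation, and a factorization. -/
abbrev GraphData (r g : ℕ) {V : Type} [Fintype V] (μ : V → ℕ) : Type :=
  Σ e : (Σ v, Fin (μ v)) ≃ Fin (∑ v, μ v),
    {w : Fin (numEdges r g μ) → Fin (∑ v, μ v) × Fin (∑ v, μ v) //
      IsFactorization r (e.permCongr (stdPerm μ)) (List.ofFn w)}

theorem semiconj_permCongr {X Y : Type} (e : X ≃ Y) (σ : Perm X) :
    Function.Semiconj e σ (e.permCongr σ) := by
  intro x
  simp [Equiv.permCongr_apply]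

theorem permCongr_eq_of_semiconj {X Y : Type} {e : X ≃ Y} {σ : Perm X} {τ : Perm Y}
    (h : Function.Semiconj e σ τ) : e.permCongr σ = τ := by
  ext y
  rw [Equiv.permCongr_apply, h, apply_symm_apply]

/-- The arrowed Hurwitz graph determined by its data. -/
def GraphData.toGraph [Nonempty V] (hr : 0 < r) (hμ : ∀ v, 0 < μ v) (D : GraphData r g μ) :
    ArrowedGraph r g μ where
  rot := graphRot (D.1.permCongr (stdPerm μ)) D.2.1
  vert x := (D.1.symm (dartDot D.2.1 x)).1
  arrow v := D.1 ⟨v, ⟨0, hμ v⟩⟩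
  vert_eq_iff x y := by
    rw [graphRot_sameCycle_iff, ← stdPerm_sameCycle_iff,
      ← sameCycle_semiconj_iff (semiconj_permCongr D.1 (stdPerm μ)), apply_symm_apply,
      apply_symm_apply]
  vert_arrow v := by simp [dartDot]
  card_dots v := by
    rw [← Nat.card_fin (μ v)]
    exact (Nat.card_congr (D.1.symm.subtypeEquiv (p := fun k => (D.1.symm k).1 = v)
      (q := fun x => x.1 = v) fun k => Iff.rfl)).trans
      (Nat.card_congr (Equiv.sigmaSubtype v))
  connected := graphRot_connected_iff.2 D.2.2.trans
  euler := by
    have hf := (graphRot_face_dots_iff D.2.2.ne r).2 D.2.2.cycles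
    have h1 : ∑ v, μ v = Nat.card (Quotient (Perm.SameCycle.setoid
        (faceWalk (graphRot (D.1.permCongr (stdPerm μ)) D.2.1)))) * r := by
      have := card_eq_card_quotient_mul (fun k => Quotient.mk (Perm.SameCycle.setoid
        (faceWalk (graphRot (D.1.permCongr (stdPerm μ)) D.2.1))) (Sum.inl k)) r fun q => by
        induction q using Quotient.inductionOn with
        | h x =>
          refine (Nat.card_congr (Equiv.subtypeEquivRight fun k => ?_)).trans (hf x)
          rw [Quotient.eq]
          exact ⟨fun h => Perm.SameCycle.symm h, fun h => Perm.SameCycle.symm h⟩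
      rwa [Nat.card_fin] at this
    have h2 := Nat.div_eq_of_eq_mul_left hr h1
    have h3 : 0 < ∑ v, μ v := Finset.sum_pos (fun v _ => hμ v) Finset.univ_nonempty
    rw [← h2]
    -- There is at least one face and one vertex, so the subtraction of `2` in `numEdges` is not
    -- truncated; the Euler relation then holds by the very choice of the number of edges.
    have h4 : 0 < (∑ v, μ v) / r := by
      rcases Nat.eq_zero_or_pos ((∑ v, μ v) / r) with h | h
      · rw [h1, ← h2, h, zero_mul] at h3
        exact absurd h3 (lt_irrefl 0)
      · exact h
    have h5 : 0 < Fintype.card V := Fintype.card_pos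
    rw [numEdges]
    omega
  face_dots := (graphRot_face_dots_iff D.2.2.ne r).2 D.2.2.cycles
  label_lt := graphRot_label_lt D.2.2.ne

theorem ArrowedGraph.ext_data {G G' : ArrowedGraph r g μ} (h1 : G.rot = G'.rot)
    (h2 : G.vert = G'.vert) (h3 : G.arrow = G'.arrow) : G = G' := by
  cases G
  cases G'
  simp only at h1 h2 h3
  subst h1 h2 h3
  rfl

/-- The rotation determines `σ` and the pairs, and the arrows pin down the parametrization by the
standard permutation. -/
theorem GraphData.toGraph_injective [Nonempty V] (hr : 0 < r) (hμ : ∀ v, 0 < μ v) :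
    Function.Injective (GraphData.toGraph (g := g) hr hμ) := by
  rintro ⟨e, w, hw⟩ ⟨e', w', hw'⟩ h
  have hrot := congrArg ArrowedGraph.rot h
  have harrow := congrArg ArrowedGraph.arrow h
  obtain ⟨h1, h2⟩ := rotOfList_injective nodup_finRange_reverse hrot
    (fun i _ => halfEdgeDot_ne hw.ne i) (fun i _ => halfEdgeDot_ne hw'.ne i)
  obtain rfl : w = w' := by
    ext1 i
    exact Prod.ext (h2 i (mem_finRange_reverse i) false) (h2 i (mem_finRange_reverse i) true)
  obtain rfl : e = e' := by
    have he := semiconj_permCongr e (stdPerm μ)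
    change e.permCongr (stdPerm μ) = e'.permCongr (stdPerm μ) at h1
    rw [h1] at he
    exact DFunLike.coe_injective (semiconj_stdPerm_eq he (semiconj_permCongr e' (stdPerm μ))
      fun v _ => congrFun harrow v)
  rfl

theorem GraphData.toGraph_surjective [Nonempty V] (hr : 0 < r) (hμ : ∀ v, 0 < μ v) :
    Function.Surjective (GraphData.toGraph (g := g) hr hμ) := by
  intro G
  have : Nonempty (Fin (∑ v, μ v)) := ⟨G.arrow (Classical.arbitrary V)⟩
  obtain ⟨σ, p, hp, hrot⟩ := exists_rotOfList pairwise_finRange_reverse G.rot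
    (fun h hh => absurd (mem_finRange_reverse _) hh) fun h h' _ hh => by
      -- When the rotation takes `h` to `h'`, the face walk takes the opposite half of `h'` to `h`;
      -- the label condition of the graph applies at this corner.
      refine G.label_lt (Sum.inr (h'.1, !h'.2)) _ rfl h.1 ?_
      have : faceWalk G.rot (Sum.inr (h'.1, !h'.2)) = Sum.inr h := by
        rw [faceWalk, Perm.mul_apply, Perm.inv_eq_iff_eq, hh]
        simp [edgeFlip]
      rw [this]
      rfl
  set w : Fin (numEdges r g μ) → Fin (∑ v, μ v) × Fin (∑ v, μ v) :=
    fun i => (p (i, false), p (i, true)) with hw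
  have hpw : p = halfEdgeDot w := by
    ext1 ⟨i, b⟩
    cases b <;> rfl
  replace hrot : G.rot = graphRot σ w := by rw [hrot, hpw]; rfl
  have hne : ∀ q ∈ List.ofFn w, q.1 ≠ q.2 := by
    intro q hq
    obtain ⟨i, rfl⟩ := List.mem_ofFn.1 hq
    exact hp i (mem_finRange_reverse i)
  have hiff : ∀ k k', G.vert (Sum.inl k) = G.vert (Sum.inl k') ↔ σ.SameCycle k k' := by
    intro k k'
    rw [G.vert_eq_iff, hrot, graphRot_sameCycle_iff]
    rfl
  obtain ⟨e, he, hearrow, hevert⟩ := exists_semiconj_stdPerm hiff G.vert_arrow G.card_dots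
  have hσ := permCongr_eq_of_semiconj he
  refine ⟨⟨e, w, ?_⟩, ?_⟩
  · rw [hσ]
    refine ⟨hne, ?_, ?_⟩
    · rw [← graphRot_connected_iff, ← hrot]
      exact G.connected
    · rw [← graphRot_face_dots_iff hne, ← hrot]
      exact G.face_dots
  · refine ArrowedGraph.ext_data ?_ ?_ ?_
    · exact (congrArg (fun τ => graphRot τ w) hσ).trans hrot.symm
    · ext1 x
      change (e.symm (dartDot w x)).1 = G.vert x
      rw [← hevert, apply_symm_apply, G.vert_eq_iff, hrot]
      exact (graphRot_sameCycle_dartDot x).symm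
    · ext1 v
      exact hearrow v (hμ v)

theorem card_arrowedGraph [Nonempty V] (hr : 0 < r) (hμ : ∀ v, 0 < μ v) [DecidableEq V] :
    Nat.card (ArrowedGraph r g μ) = (∑ v, μ v).factorial *
      numFactorizations r (stdPerm μ) (numEdges r g μ) := by
  rw [← Nat.card_eq_of_bijective _ ⟨GraphData.toGraph_injective (g := g) hr hμ,
    GraphData.toGraph_surjective hr hμ⟩, Nat.card_sigma]
  have h : ∀ e : (Σ v, Fin (μ v)) ≃ Fin (∑ v, μ v),
      Nat.card {w : Fin (numEdges r g μ) → Fin (∑ v, μ v) × Fin (∑ v, μ v) //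
        IsFactorization r (e.permCongr (stdPerm μ)) (List.ofFn w)} =
      numFactorizations r (stdPerm μ) (numEdges r g μ) := fun e =>
    (numFactorizations_semiconj (semiconj_permCongr e (stdPerm μ)) r _).symm
  simp only [h, Finset.sum_const, Finset.card_univ, smul_eq_mul]
  congr 1
  rw [Fintype.card_equiv (Fintype.equivOfCardEq (by simp))]
  simp

end Graph

/-! ### Orbit counting: the sum over isomorphism classes -/

section Relabel

variable {d s : ℕ}

theorem eq_inl_of_edgeLabel {x : Dart d s} (h : edgeLabel x = none) : ∃ k, x = Sum.inl k := by
  rcases x with k | p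
  · exact ⟨k, rfl⟩
  · simp [edgeLabel] at h

theorem eq_inr_of_edgeLabel {x : Dart d s} {e : Fin s} (h : edgeLabel x = some e) :
    ∃ b, x = Sum.inr (e, b) := by
  rcases x with k | ⟨e', b⟩
  · simp [edgeLabel] at h
  · simp only [edgeLabel, Option.some.injEq] at h
    exact ⟨b, by rw [h]⟩

variable {f : Perm (Dart d s)}

theorem edgeLabel_inv (hf : ∀ x, edgeLabel (f x) = edgeLabel x) (x : Dart d s) :
    edgeLabel (f⁻¹ x) = edgeLabel x := by
  rw [← hf (f⁻¹ x)]
  simp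

theorem exists_dotPerm (hf : ∀ x, edgeLabel (f x) = edgeLabel x) :
    ∃ π : Perm (Fin d), ∀ k, f (Sum.inl k) = Sum.inl (π k) := by
  choose a ha using fun k => eq_inl_of_edgeLabel (hf (Sum.inl k))
  choose b hb using fun k => eq_inl_of_edgeLabel (edgeLabel_inv hf (Sum.inl k))
  refine ⟨⟨a, b, fun k => ?_, fun k => ?_⟩, ha⟩
  · exact Sum.inl_injective ((hb (a k)).symm.trans (Perm.inv_eq_iff_eq.2 (ha k).symm))
  · exact Sum.inl_injective ((ha (b k)).symm.trans (Perm.inv_eq_iff_eq.1 (hb k)).symm)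

/-- The two half-edges of an edge are all the darts with its label, so a label-preserving
permutation fixes or exchanges them. Isomorphisms hence need no separate compatibility with the
flip. -/
theorem mul_edgeFlip (hf : ∀ x, edgeLabel (f x) = edgeLabel x) :
    f * edgeFlip d s = edgeFlip d s * f := by
  ext1 x
  rw [Perm.mul_apply, Perm.mul_apply]
  rcases x with k | ⟨e, b⟩
  · obtain ⟨k', hk'⟩ := eq_inl_of_edgeLabel (hf (Sum.inl k))
    change f (Sum.inl k) = _
    rw [hk']
    rfl
  · obtain ⟨b₁, h₁⟩ := eq_inr_of_edgeLabel (hf (Sum.inr (e, b)))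
    obtain ⟨b₂, h₂⟩ := eq_inr_of_edgeLabel (hf (Sum.inr (e, !b)))
    change f (Sum.inr (e, !b)) = _
    rw [h₁, h₂]
    change _ = Sum.inr (e, !b₁)
    have : b₂ ≠ b₁ := by
      rintro rfl
      have := f.injective (h₁.trans h₂.symm)
      simp at this
    rw [Bool.eq_not_of_ne this]

/-- The permutations are independent on the fibres of `edgeLabel`: one fibre of `d` dots and `s`
fibres of two half-edges. -/
theorem card_label_preserving :
    Nat.card {f : Perm (Dart d s) // ∀ x, edgeLabel (f x) = edgeLabel x} = d.factorial * 2 ^ s := by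
  have h := DomMulAct.stabilizer_card (edgeLabel : Dart d s → Option (Fin s))
  rw [Fintype.prod_option] at h
  have h1 : Fintype.card {a : Dart d s // edgeLabel a = none} = d := by
    refine (Fintype.card_congr (Equiv.ofBijective (fun k : Fin d =>
      (⟨Sum.inl k, rfl⟩ : {a : Dart d s // edgeLabel a = none}))
      ⟨fun k k' h => Sum.inl_injective (congrArg Subtype.val h), fun x => ?_⟩)).symm.trans
      (Fintype.card_fin d)
    obtain ⟨k, hk⟩ := eq_inl_of_edgeLabel x.2
    exact ⟨k, Subtype.ext hk.symm⟩
  have h2 : ∀ e : Fin s, Fintype.card {a : Dart d s // edgeLabel a = some e} = 2 := by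
    intro e
    rw [← Fintype.card_bool]
    refine Fintype.card_congr (Equiv.ofBijective (fun b : Bool =>
      (⟨Sum.inr (e, b), rfl⟩ : {a : Dart d s // edgeLabel a = some e}))
      ⟨fun k k' h => (Prod.mk.inj (Sum.inr_injective (congrArg Subtype.val h))).2,
        fun x => ?_⟩).symm
    obtain ⟨k, hk⟩ := eq_inr_of_edgeLabel x.2
    exact ⟨k, Subtype.ext hk.symm⟩
  simp only [h1, h2, Nat.factorial_two, Finset.prod_const, Finset.card_univ, Fintype.card_fin] at h
  rw [← h, ← Nat.card_eq_fintype_card]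
  exact Nat.card_congr (Equiv.subtypeEquivRight fun f => funext_iff.symm)

end Relabel

namespace ArrowedGraph

variable {r g : ℕ} {V : Type} [Fintype V] {μ : V → ℕ}

/-- Every permutation of the darts that preserves the edge labels is an isomorphism onto some
graph. -/
theorem exists_relabel (G : ArrowedGraph r g μ) (f : Perm (Dart (∑ v, μ v) (numEdges r g μ)))
    (hf : ∀ x, edgeLabel (f x) = edgeLabel x) :
    ∃ (G' : ArrowedGraph r g μ) (φ : Iso G G'), φ.toPerm = f := by
  obtain ⟨π, hπ⟩ := exists_dotPerm hf
  have hπ' : ∀ k, f⁻¹ (Sum.inl (π k)) = Sum.inl k := fun k => by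
    rw [Perm.inv_eq_iff_eq, hπ]
  have hflip : f * edgeFlip _ _ * f⁻¹ = edgeFlip _ _ := by
    rw [mul_edgeFlip hf, mul_inv_cancel_right]
  have hface : faceWalk (f * G.rot * f⁻¹) = f * faceWalk G.rot * f⁻¹ := by
    rw [faceWalk, ← hflip, faceWalk, hflip]
    nth_rewrite 1 [← hflip]
    group
  refine ⟨⟨f * G.rot * f⁻¹, fun x => G.vert (f⁻¹ x), fun v => π (G.arrow v), fun x y => ?_,
    fun v => ?_, fun v => ?_, fun x y => ?_, ?_, fun x => ?_, fun x α hα β hβ => ?_⟩,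
    ⟨f, hf, fun x => ?_, fun x => ?_, fun v => hπ _⟩, rfl⟩
  · rw [G.vert_eq_iff, Perm.sameCycle_conj]
  · rw [hπ', G.vert_arrow]
  · rw [← G.card_dots v]
    exact (Nat.card_congr (π.subtypeEquiv fun k => by rw [hπ'])).symm
  · obtain ⟨h, hh, hxy⟩ := G.connected (f⁻¹ x) (f⁻¹ y)
    refine ⟨f * h * f⁻¹, ?_, ?_⟩
    · have := Subgroup.mem_map_of_mem (MulAut.conj f).toMonoidHom hh
      rw [MonoidHom.map_closure, Set.image_pair] at this
      simpa only [MulEquiv.coe_toMonoidHom, MulAut.conj_apply, hflip] using this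
    · rw [Perm.mul_apply, Perm.mul_apply, hxy]
      simp
  · rw [← G.euler, hface]
    congr 2
    exact Nat.card_congr (Quotient.congr f⁻¹ fun x y => Perm.sameCycle_conj)
  · rw [hface]
    refine (Nat.card_congr (π.subtypeEquiv fun k => ?_)).symm.trans (G.face_dots (f⁻¹ x))
    rw [Perm.sameCycle_conj, hπ']
  · rw [hface, Perm.mul_apply, Perm.mul_apply, hf] at hβ
    rw [← edgeLabel_inv hf] at hα
    exact G.label_lt _ α hα β hβ
  · simp
  · simp

theorem Iso.toPerm_injective {G G' : ArrowedGraph r g μ} :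
    Function.Injective (Iso.toPerm (G := G) (G' := G')) := by
  rintro ⟨a, _, _, _, _⟩ ⟨b, _, _, _, _⟩ h
  simp only at h
  subst h
  rfl

instance (G G' : ArrowedGraph r g μ) : Finite (Iso G G') :=
  Finite.of_injective _ Iso.toPerm_injective

/-- The composition of isomorphisms. -/
def Iso.trans {G G' G'' : ArrowedGraph r g μ} (f : Iso G G') (h : Iso G' G'') : Iso G G'' where
  toPerm := h.toPerm * f.toPerm
  edgeLabel_eq x := by simp [h.edgeLabel_eq, f.edgeLabel_eq]
  map_rot x := by simp [h.map_rot, f.map_rot]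
  map_vert x := by simp [h.map_vert, f.map_vert]
  map_arrow v := by simp [h.map_arrow, f.map_arrow]

/-- Composition with `f` is injective. Used for `f` and an inverse, this shows that isomorphic
graphs receive equally many isomorphisms. -/
theorem Iso.card_le {G G' : ArrowedGraph r g μ} (f : Iso G G') (G'' : ArrowedGraph r g μ) :
    Nat.card (Iso G'' G) ≤ Nat.card (Iso G'' G') := by
  refine Nat.card_le_card_of_injective (fun h => h.trans f) fun h h' e => ?_
  have := congrArg Iso.toPerm e
  exact Iso.toPerm_injective (mul_left_cancel this)

theorem eq_of_toPerm_eq {G G' G'' : ArrowedGraph r g μ} (f : Iso G G') (f' : Iso G G'')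
    (h : f.toPerm = f'.toPerm) : G' = G'' := by
  have h' : ∀ x, f.toPerm (f.toPerm⁻¹ x) = x := fun x => by simp
  refine ext_data ?_ ?_ ?_
  · ext1 x
    rw [← h' x, ← f.map_rot, h, ← f'.map_rot]
  · ext1 x
    rw [← h' x, f.map_vert, h, f'.map_vert]
  · ext1 v
    have := f.map_arrow v
    rw [h, f'.map_arrow] at this
    exact (Sum.inl_injective this).symm

/-- Each label-preserving permutation transports `G` to exactly one graph, so the isomorphisms out
of `G` exhaust the group of these permutations. -/
theorem sum_card_iso [Fintype (ArrowedGraph r g μ)] (G : ArrowedGraph r g μ) :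
    ∑ G', Nat.card (Iso G G') =
      (∑ v, μ v).factorial * 2 ^ numEdges r g μ := by
  rw [← card_label_preserving, ← Nat.card_sigma]
  refine Nat.card_eq_of_bijective
    (fun φ : Σ G', Iso G G' => ⟨φ.2.toPerm, φ.2.edgeLabel_eq⟩) ⟨?_, ?_⟩
  · rintro ⟨G', f⟩ ⟨G'', f'⟩ h
    have h : f.toPerm = f'.toPerm := congrArg Subtype.val h
    obtain rfl := eq_of_toPerm_eq f f' h
    rw [Iso.toPerm_injective h]
  · rintro ⟨f, hf⟩
    obtain ⟨G', φ, hφ⟩ := exists_relabel G f hf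
    exact ⟨⟨G', φ⟩, Subtype.ext hφ⟩

/-- This is the orbit-stabilizer theorem: a class consists of (order of the group) / |Aut| graphs,
so each class contributes its number of elements divided by the order of the group. -/
theorem sum_quotient_inv_card_iso :
    ∑ q : Quotient (isoSetoid r g μ), 1 / (Nat.card (Iso q.out q.out) : ℚ) =
      Nat.card (ArrowedGraph r g μ) / ((∑ v, μ v).factorial * 2 ^ numEdges r g μ : ℕ) := by
  classical
  have := Fintype.ofFinite (ArrowedGraph r g μ)
  have hN : (((∑ v, μ v).factorial * 2 ^ numEdges r g μ : ℕ) : ℚ) ≠ 0 := by positivity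
  rw [eq_div_iff hN, Nat.card_eq_fintype_card, ← Finset.card_univ,
    Finset.card_eq_sum_card_fiberwise (f := Quotient.mk (isoSetoid r g μ))
      (t := Finset.univ) (by simp), Finset.sum_mul, Nat.cast_sum]
  refine Finset.sum_congr rfl fun q _ => ?_
  have hpos : (Nat.card (Iso q.out q.out) : ℚ) ≠ 0 := by
    have : Nonempty (Iso q.out q.out) := (isoSetoid r g μ).refl _
    exact_mod_cast Nat.card_pos.ne'
  rw [div_mul_eq_mul_div, one_mul, div_eq_iff hpos, ← sum_card_iso q.out, ← Nat.cast_mul]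
  congr 1
  rw [← smul_eq_mul, ← Finset.sum_const, Finset.sum_filter]
  refine Finset.sum_congr rfl fun G' _ => ?_
  split_ifs with h
  · have h1 : Quotient.mk (isoSetoid r g μ) q.out = Quotient.mk _ G' := by rw [h, Quotient.out_eq]
    obtain ⟨f⟩ := Quotient.exact h1
    obtain ⟨f'⟩ := (isoSetoid r g μ).symm ⟨f⟩
    exact le_antisymm (f'.card_le _) (f.card_le _)
  · rw [Nat.card_eq_zero]
    left
    constructor
    intro f
    refine h ?_
    rw [← Quotient.out_eq q]
    exact Quotient.sound ((isoSetoid r g μ).symm ⟨f⟩)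

end ArrowedGraph

/-- The `d!` parametrizations of the dots cancel against the relabelings of the dots; the factor `2
^ s` remains because the pairs of a factorization are ordered. -/
theorem count_eq {r g : ℕ} {V : Type} [Fintype V] [DecidableEq V] {μ : V → ℕ} [Nonempty V]
    (hr : 0 < r) (hμ : ∀ v, 0 < μ v) :
    count r g μ = numFactorizations r (stdPerm μ) (numEdges r g μ) /
      (2 ^ numEdges r g μ * (numEdges r g μ).factorial) := by
  rw [count, ArrowedGraph.sum_quotient_inv_card_iso, card_arrowedGraph hr hμ]
  have : ((∑ v, μ v).factorial : ℚ) ≠ 0 := by positivity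
  push_cast
  field_simp

/-! ### Words in two alphabets -/

section Shuffle

variable {α β : Type}

/-- The subsequence of the left letters of a word. -/
def lefts (l : List (α ⊕ β)) : List α := l.filterMap Sum.getLeft?

/-- The subsequence of the right letters of a word. -/
def rights (l : List (α ⊕ β)) : List β := l.filterMap Sum.getRight?

theorem lefts_cons_inl (a : α) (l : List (α ⊕ β)) : lefts (Sum.inl a :: l) = a :: lefts l := rfl
theorem lefts_cons_inr (b : β) (l : List (α ⊕ β)) : lefts (Sum.inr b :: l) = lefts l := rfl
theorem rights_cons_inl (a : α) (l : List (α ⊕ β)) : rights (Sum.inl a :: l) = rights l := rfl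
theorem rights_cons_inr (b : β) (l : List (α ⊕ β)) : rights (Sum.inr b :: l) = b :: rights l := rfl

theorem mem_lefts {l : List (α ⊕ β)} {a : α} : a ∈ lefts l ↔ Sum.inl a ∈ l := by
  simp [lefts]

theorem mem_rights {l : List (α ⊕ β)} {b : β} : b ∈ rights l ↔ Sum.inr b ∈ l := by
  simp [rights]

theorem sum_ofFn_succ [Fintype α] (s : ℕ) (f : List α → ℕ) :
    ∑ w : Fin (s + 1) → α, f (List.ofFn w) = ∑ a, ∑ w : Fin s → α, f (a :: List.ofFn w) := by
  rw [← Fintype.sum_prod_type', ← (Fin.consEquiv fun _ : Fin (s + 1) => α).sum_comp]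
  refine Finset.sum_congr rfl fun p _ => ?_
  simp [Fin.consEquiv, List.ofFn_succ]

/-- Words with two kinds of letters are shuffles of two words. -/
theorem sum_shuffle [Fintype α] [Fintype β] (s : ℕ) (f : List α → ℕ) (h : List β → ℕ) :
    ∑ w : Fin s → α ⊕ β, f (lefts (List.ofFn w)) * h (rights (List.ofFn w)) =
      ∑ p ∈ Finset.HasAntidiagonal.antidiagonal s, s.choose p.1 *
        ((∑ w : Fin p.1 → α, f (List.ofFn w)) * ∑ w : Fin p.2 → β, h (List.ofFn w)) := by
  induction s generalizing f h with
  | zero => simp [lefts, rights]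
  | succ s ih =>
    rw [sum_ofFn_succ s fun l => f (lefts l) * h (rights l), Fintype.sum_sum_type]
    simp only [lefts_cons_inl, lefts_cons_inr, rights_cons_inl, rights_cons_inr]
    have h1 : ∀ a, ∑ w : Fin s → α ⊕ β, f (a :: lefts (List.ofFn w)) * h (rights (List.ofFn w)) = _ :=
      fun a => ih (fun l => f (a :: l)) h
    have h2 : ∀ b, ∑ w : Fin s → α ⊕ β, f (lefts (List.ofFn w)) * h (b :: rights (List.ofFn w)) = _ :=
      fun b => ih f fun l => h (b :: l)
    simp only [h1, h2]
    -- Pascal's rule corresponds to the two kinds of first letter.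
    have hp := Finset.sum_antidiagonal_choose_succ_mul (R := ℕ) (fun i j =>
      (∑ w : Fin i → α, f (List.ofFn w)) * ∑ w : Fin j → β, h (List.ofFn w)) s
    simp only [Nat.cast_id] at hp
    rw [hp, Finset.sum_comm, Finset.sum_comm (s := (Finset.univ : Finset β)), add_comm]
    congr 1
    · refine Finset.sum_congr rfl fun p _ => ?_
      rw [sum_ofFn_succ, ← Finset.mul_sum, ← Finset.mul_sum]
    · refine Finset.sum_congr rfl fun p hp => ?_
      rw [sum_ofFn_succ, ← Finset.mul_sum, ← Finset.sum_mul,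
        Nat.choose_symm_of_eq_add (Finset.HasAntidiagonal.mem_antidiagonal.1 hp).symm]

theorem natCard_subtype_eq_sum [Fintype α] (P : α → Prop) [DecidablePred P] :
    Nat.card {a // P a} = ∑ a, if P a then 1 else 0 := by
  rw [Nat.card_eq_fintype_card, Fintype.card_subtype, Finset.card_filter]

/-- Restriction to words with letters in the range of an injection. -/
theorem natCard_exists_map {s : ℕ} {ι : α → β} (hι : Function.Injective ι) (P : List α → Prop) :
    Nat.card {w : Fin s → β // ∃ l, List.ofFn w = l.map ι ∧ P l} =
      Nat.card {w : Fin s → α // P (List.ofFn w)} := by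
  symm
  refine Nat.card_eq_of_bijective
    (fun w => ⟨ι ∘ w.1, List.ofFn w.1, by rw [List.map_ofFn], w.2⟩) ⟨?_, ?_⟩
  · intro w w' h
    exact Subtype.ext (hι.comp_left (congrArg Subtype.val h))
  · rintro ⟨w, l, hl, hP⟩
    have hlen : l.length = s := by simpa using (congrArg List.length hl).symm
    subst hlen
    refine ⟨⟨l.get, by rwa [List.ofFn_get]⟩, Subtype.ext (List.ofFn_injective ?_)⟩
    change List.ofFn (ι ∘ l.get) = _
    rw [hl, ← List.map_ofFn, List.ofFn_get]

end Shuffle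

/-! ### Removing the first transposition -/

section Bridged

variable {X Y : Type}

/-- Like `IsFactorization`, but the points `a` and `b` may be used as well to connect the orbits. -/
structure IsBridged [DecidableEq X] (r : ℕ) (σ : Perm X) (a b : X) (l : List (X × X)) : Prop where
  ne : ∀ p ∈ l, p.1 ≠ p.2
  trans : JointlyTransitive σ ((a, b) :: l)
  cycles : CyclesHaveCard r (mulSwaps σ l)

/-- A set that contains both or neither of `a` and `b` is invariant under `swap a b`, so it is
invariant under `σ` exactly when it is invariant under `σ * swap a b`. -/
theorem jointlyTransitive_mul_swap [DecidableEq X] {σ : Perm X} {a b : X} {l : List (X × X)} :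
    JointlyTransitive (σ * swap a b) ((a, b) :: l) ↔ JointlyTransitive σ ((a, b) :: l) := by
  have key : ∀ A : Set X, (a ∈ A ↔ b ∈ A) →
      ((∀ x, (σ * swap a b) x ∈ A ↔ x ∈ A) ↔ ∀ x, σ x ∈ A ↔ x ∈ A) := by
    intro A h
    have hs : ∀ x, swap a b x ∈ A ↔ x ∈ A := by
      intro x
      rw [swap_apply_def]
      split_ifs with h1 h2
      · rw [h1, h]
      · rw [h2, h]
      · rfl
    refine ⟨fun H x => ?_, fun H x => by rw [Perm.mul_apply, H, hs]⟩
    have := H (swap a b x)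
    rwa [Perm.mul_apply, swap_apply_self, hs] at this
  refine forall_congr' fun A => ⟨fun H h1 h2 => H ((key A ?_).2 h1) h2,
    fun H h1 h2 => H ((key A ?_).1 h1) h2⟩ <;> exact h2 _ List.mem_cons_self

theorem isFactorization_cons_iff [DecidableEq X] {r : ℕ} {σ : Perm X} {a b : X}
    {l : List (X × X)} :
    IsFactorization r σ ((a, b) :: l) ↔ a ≠ b ∧ IsBridged r (σ * swap a b) a b l := by
  constructor
  · intro h
    refine ⟨h.ne _ List.mem_cons_self, fun p hp => h.ne p (List.mem_cons_of_mem _ hp),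
      jointlyTransitive_mul_swap.2 h.trans, ?_⟩
    rw [← mulSwaps_cons σ (a, b)]
    exact h.cycles
  · rintro ⟨hab, h⟩
    refine ⟨?_, jointlyTransitive_mul_swap.1 h.trans, ?_⟩
    · simp only [List.mem_cons, forall_eq_or_imp]
      exact ⟨hab, h.ne⟩
    · rw [mulSwaps_cons]
      exact h.cycles

theorem JointlyTransitive.cons {σ : Perm X} {l : List (X × X)} (h : JointlyTransitive σ l)
    (p : X × X) : JointlyTransitive σ (p :: l) :=
  fun A hA hl => h A hA fun q hq => hl q (List.mem_cons_of_mem _ hq)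

theorem mem_iff_of_sameCycle {σ : Perm X} {A : Set X} (hA : ∀ x, σ x ∈ A ↔ x ∈ A) {x y : X}
    (h : σ.SameCycle x y) : x ∈ A ↔ y ∈ A :=
  iff_of_eq (rel_of_sameCycle (Setoid.ker (· ∈ A)) id (fun x => propext (hA x).symm) h)

/-- The bridge adds nothing when `σ` already connects its ends. This is the situation after a join.
-/
theorem isBridged_iff_of_sameCycle [DecidableEq X] {r : ℕ} {σ : Perm X} {a b : X}
    {l : List (X × X)} (hab : σ.SameCycle a b) : IsBridged r σ a b l ↔ IsFactorization r σ l := by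
  refine ⟨fun h => ⟨h.ne, fun A hA hl => h.trans A hA ?_, h.cycles⟩,
    fun h => ⟨h.ne, h.trans.cons _, h.cycles⟩⟩
  simp only [List.mem_cons, forall_eq_or_imp]
  exact ⟨mem_iff_of_sameCycle hA hab, hl⟩

theorem IsBridged.semiconj [DecidableEq X] [DecidableEq Y] {σ : Perm X} {τ : Perm Y} {e : X ≃ Y}
    (he : Function.Semiconj e σ τ) {r : ℕ} {a b : X} {l : List (X × X)} (h : IsBridged r σ a b l) :
    IsBridged r τ (e a) (e b) (l.map (Prod.map e e)) where
  ne := by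
    intro p hp
    obtain ⟨q, hq, rfl⟩ := List.mem_map.1 hp
    simpa using h.ne q hq
  trans := h.trans.semiconj he
  cycles := h.cycles.semiconj (semiconj_mulSwaps e.injective he l)

theorem isBridged_semiconj_iff [DecidableEq X] [DecidableEq Y] {σ : Perm X} {τ : Perm Y}
    {e : X ≃ Y} (he : Function.Semiconj e σ τ) {r : ℕ} {a b : X} {l : List (X × X)} :
    IsBridged r τ (e a) (e b) (l.map (Prod.map e e)) ↔ IsBridged r σ a b l := by
  refine ⟨fun h => ?_, IsBridged.semiconj he⟩
  simpa [Function.comp_def, Prod.map] using h.semiconj (semiconj_symm he)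

/-- The number of sequences of `s` pairs with the property `IsBridged`. -/
noncomputable def numBridged [DecidableEq X] (r : ℕ) (σ : Perm X) (a b : X) (s : ℕ) : ℕ :=
  Nat.card {w : Fin s → X × X // IsBridged r σ a b (List.ofFn w)}

theorem numBridged_semiconj [DecidableEq X] [DecidableEq Y] {σ : Perm X} {τ : Perm Y} {e : X ≃ Y}
    (he : Function.Semiconj e σ τ) (r : ℕ) (a b : X) (s : ℕ) :
    numBridged r σ a b s = numBridged r τ (e a) (e b) s := by
  refine Nat.card_congr ((Equiv.piCongrRight fun _ : Fin s => prodCongr e e).subtypeEquiv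
    fun w => ?_)
  rw [← isBridged_semiconj_iff he, List.map_ofFn]
  rfl

theorem numBridged_of_sameCycle [DecidableEq X] {r : ℕ} {σ : Perm X} {a b : X}
    (hab : σ.SameCycle a b) (s : ℕ) : numBridged r σ a b s = numFactorizations r σ s :=
  Nat.card_congr (Equiv.subtypeEquivRight fun _ => isBridged_iff_of_sameCycle hab)

theorem numFactorizations_succ [DecidableEq X] [Fintype X] (r : ℕ) (σ : Perm X) (s : ℕ) :
    numFactorizations r σ (s + 1) =
      ∑ a, ∑ b, if a = b then 0 else numBridged r (σ * swap a b) a b s := by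
  classical
  rw [numFactorizations, natCard_subtype_eq_sum,
    sum_ofFn_succ s fun l => if IsFactorization r σ l then 1 else 0, Fintype.sum_prod_type]
  refine Finset.sum_congr rfl fun a _ => Finset.sum_congr rfl fun b _ => ?_
  simp only [isFactorization_cons_iff]
  split_ifs with h
  · simp [h]
  · rw [numBridged, natCard_subtype_eq_sum]
    simp [h]

end Bridged

/-! ### Factorizations on a disjoint union -/

section Sum

variable {X Y : Type} {σ : Perm X} {τ : Perm Y}

/-- Pairs in `X` and pairs in `Y` as pairs in the disjoint union. -/
def pairIncl : (X × X) ⊕ (Y × Y) → (X ⊕ Y) × (X ⊕ Y) :=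
  Sum.elim (Prod.map Sum.inl Sum.inl) (Prod.map Sum.inr Sum.inr)

theorem pairIncl_injective : Function.Injective (pairIncl : (X × X) ⊕ (Y × Y) → _) := by
  rintro (⟨a, b⟩ | ⟨a, b⟩) (⟨c, d⟩ | ⟨c, d⟩) h <;> simp_all [pairIncl]

/-- The bridge is the only link between the two sides. To test transitivity on one side, an
invariant set there is extended by everything or nothing on the other, according to whether it
contains its end of the bridge. -/
theorem jointlyTransitive_sum {a : X} {b : Y} {l : List ((X × X) ⊕ (Y × Y))} :
    JointlyTransitive (sumCongr σ τ) ((Sum.inl a, Sum.inr b) :: l.map pairIncl) ↔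
      JointlyTransitive σ (lefts l) ∧ JointlyTransitive τ (rights l) := by
  have hinv : ∀ (A : Set X) (B : Set Y), (∀ x, σ x ∈ A ↔ x ∈ A) → (∀ y, τ y ∈ B ↔ y ∈ B) →
      (∀ p ∈ lefts l, p.1 ∈ A ↔ p.2 ∈ A) → (∀ p ∈ rights l, p.1 ∈ B ↔ p.2 ∈ B) →
      (a ∈ A ↔ b ∈ B) →
      JointlyTransitive (sumCongr σ τ) ((Sum.inl a, Sum.inr b) :: l.map pairIncl) →
      ∀ x, Sum.elim (· ∈ A) (· ∈ B) x → ∀ y, Sum.elim (· ∈ A) (· ∈ B) y := by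
    intro A B hA hB hl hr hab h
    refine h {z | Sum.elim (· ∈ A) (· ∈ B) z} ?_ ?_
    · rintro (x | y)
      · exact hA x
      · exact hB y
    · simp only [List.mem_cons, forall_eq_or_imp, List.forall_mem_map]
      refine ⟨hab, ?_⟩
      rintro (p | p) hp
      · exact hl p (mem_lefts.2 hp)
      · exact hr p (mem_rights.2 hp)
  constructor
  · intro h
    refine ⟨fun A hA hl x hx y => ?_, fun B hB hl x hx y => ?_⟩
    · by_cases ha : a ∈ A
      · exact hinv A Set.univ hA (by simp) hl (by simp) (by simpa using ha) h (Sum.inl x) hx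
          (Sum.inl y)
      · exact absurd (hinv A ∅ hA (by simp) hl (by simp) (by simpa using ha) h (Sum.inl x) hx
          (Sum.inl a)) ha
    · by_cases hb : b ∈ B
      · exact hinv Set.univ B (by simp) hB (by simp) hl (by simpa using hb) h (Sum.inr x) hx
          (Sum.inr y)
      · exact absurd (hinv ∅ B (by simp) hB (by simp) hl (by simpa using hb) h (Sum.inr x) hx
          (Sum.inr b)) hb
  · rintro ⟨h1, h2⟩ A hA hl x hx y
    have H1 := h1 (Sum.inl ⁻¹' A) (fun x => hA (Sum.inl x)) fun p hp =>
      hl _ (List.mem_cons_of_mem _ (List.mem_map_of_mem (mem_lefts.1 hp)))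
    have H2 := h2 (Sum.inr ⁻¹' A) (fun x => hA (Sum.inr x)) fun p hp =>
      hl _ (List.mem_cons_of_mem _ (List.mem_map_of_mem (mem_rights.1 hp)))
    have hab : Sum.inl a ∈ A ↔ Sum.inr b ∈ A := hl _ List.mem_cons_self
    have ha : Sum.inl a ∈ A := by
      rcases x with x | x
      · exact H1 x hx a
      · exact hab.2 (H2 x hx b)
    rcases y with y | y
    · exact H1 a ha y
    · exact H2 b (hab.1 ha) y

theorem mulSwaps_sum [DecidableEq X] [DecidableEq Y] (l : List ((X × X) ⊕ (Y × Y))) :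
    mulSwaps (sumCongr σ τ) (l.map pairIncl) =
      sumCongr (mulSwaps σ (lefts l)) (mulSwaps τ (rights l)) := by
  induction l generalizing σ τ with
  | nil => simp [mulSwaps, lefts, rights]
  | cons p l ih =>
    rw [List.map_cons, mulSwaps_cons]
    rcases p with ⟨a, b⟩ | ⟨a, b⟩
    · rw [lefts_cons_inl, rights_cons_inl, mulSwaps_cons, ← ih]
      congr 1
      ext1 x
      rw [Perm.mul_apply]
      rcases x with x | x
      · change sumCongr σ τ (swap (Sum.inl a) (Sum.inl b) (Sum.inl x)) = _
        rw [Sum.inl_injective.swap_apply]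
        rfl
      · change sumCongr σ τ (swap (Sum.inl a) (Sum.inl b) (Sum.inr x)) = _
        rw [swap_apply_of_ne_of_ne (by simp) (by simp)]
        rfl
    · rw [lefts_cons_inr, rights_cons_inr, mulSwaps_cons, ← ih]
      congr 1
      ext1 x
      rw [Perm.mul_apply]
      rcases x with x | x
      · change sumCongr σ τ (swap (Sum.inr a) (Sum.inr b) (Sum.inl x)) = _
        rw [swap_apply_of_ne_of_ne (by simp) (by simp)]
        rfl
      · change sumCongr σ τ (swap (Sum.inr a) (Sum.inr b) (Sum.inr x)) = _
        rw [Sum.inr_injective.swap_apply]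
        rfl

theorem sameCycle_sumCongr (x : X) (z : X ⊕ Y) :
    Perm.SameCycle (sumCongr σ τ) (Sum.inl x) z ↔ ∃ y, z = Sum.inl y ∧ σ.SameCycle x y := by
  constructor
  · intro h
    have hz : Sum.elim (fun _ => True) (fun _ => False) z := by
      have := rel_of_sameCycle (Setoid.ker (Sum.elim (fun _ => True) (fun _ => False))) id
        (fun x => by rcases x with x | x <;> rfl) h
      exact (iff_of_eq this).1 trivial
    rcases z with y | y
    · refine ⟨y, rfl, ?_⟩
      refine rel_of_sameCycle (Perm.SameCycle.setoid σ)
        (Sum.elim id fun _ => x : X ⊕ Y → X) (fun z => ?_) h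
      rcases z with z | z
      · exact sameCycle_apply_self σ z
      · exact Perm.SameCycle.refl _ _
    · exact hz.elim
  · rintro ⟨y, rfl, h⟩
    exact sameCycle_semiconj (f := Sum.inl) (fun _ => rfl) h

theorem card_sameCycle_sumCongr (x : X) :
    Nat.card {k // Perm.SameCycle (sumCongr σ τ) (Sum.inl x) k} = Nat.card {k // σ.SameCycle x k} := by
  symm
  refine Nat.card_eq_of_bijective
    (fun k => ⟨Sum.inl k.1, (sameCycle_sumCongr x _).2 ⟨_, rfl, k.2⟩⟩) ⟨?_, ?_⟩
  · intro k k' h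
    exact Subtype.ext (Sum.inl_injective (congrArg Subtype.val h))
  · rintro ⟨z, hz⟩
    obtain ⟨y, rfl, hy⟩ := (sameCycle_sumCongr x _).1 hz
    exact ⟨⟨y, hy⟩, rfl⟩

theorem cyclesHaveCard_sum {r : ℕ} :
    CyclesHaveCard r (sumCongr σ τ) ↔ CyclesHaveCard r σ ∧ CyclesHaveCard r τ := by
  have hswap : Function.Semiconj (sumComm X Y) (sumCongr σ τ) (sumCongr τ σ) := by
    rintro (x | x) <;> rfl
  constructor
  · intro h
    refine ⟨fun x => ?_, fun y => ?_⟩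
    · rw [← h (Sum.inl x), card_sameCycle_sumCongr]
    · rw [← h.semiconj hswap (Sum.inl y), card_sameCycle_sumCongr]
  · rintro ⟨h1, h2⟩ (x | y)
    · rw [card_sameCycle_sumCongr, h1]
    · rw [← h2 y, ← card_sameCycle_sumCongr (τ := σ) y]
      refine Nat.card_congr ((sumComm X Y).subtypeEquiv fun z => ?_)
      rw [← sameCycle_semiconj_iff hswap]
      rfl

theorem isBridged_sum [DecidableEq X] [DecidableEq Y] {r : ℕ} {a : X} {b : Y}
    {l : List ((X × X) ⊕ (Y × Y))} :
    IsBridged r (sumCongr σ τ) (Sum.inl a) (Sum.inr b) (l.map pairIncl) ↔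
      IsFactorization r σ (lefts l) ∧ IsFactorization r τ (rights l) := by
  have hne : (∀ p ∈ l.map pairIncl, p.1 ≠ p.2) ↔
      (∀ p ∈ lefts l, p.1 ≠ p.2) ∧ ∀ p ∈ rights l, p.1 ≠ p.2 := by
    simp only [List.forall_mem_map, mem_lefts, mem_rights, Sum.forall]
    simp [pairIncl]
  constructor
  · rintro ⟨h1, h2, h3⟩
    rw [mulSwaps_sum, cyclesHaveCard_sum] at h3
    rw [hne] at h1
    rw [jointlyTransitive_sum] at h2
    exact ⟨⟨h1.1, h2.1, h3.1⟩, ⟨h1.2, h2.2, h3.2⟩⟩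
  · rintro ⟨⟨h1, h2, h3⟩, ⟨h1', h2', h3'⟩⟩
    refine ⟨hne.2 ⟨h1, h1'⟩, jointlyTransitive_sum.2 ⟨h2, h2'⟩, ?_⟩
    rw [mulSwaps_sum, cyclesHaveCard_sum]
    exact ⟨h3, h3'⟩

end Sum

/-! ### Positions of dots, and factorizations that split into two orbits -/

/-- The position of a dot in its cycle. -/
def dotPos {V : Type} {μ : V → ℕ} (x : Σ v, Fin (μ v)) : ℕ := x.2

theorem dotPos_lt {V : Type} {μ : V → ℕ} (x : Σ v, Fin (μ v)) : dotPos x < μ x.1 := x.2.2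

@[simp]
theorem dotPos_mk {V : Type} {μ : V → ℕ} (v : V) (j : Fin (μ v)) :
    dotPos (⟨v, j⟩ : Σ v, Fin (μ v)) = j := rfl

theorem dot_ext {V : Type} {μ : V → ℕ} {x y : Σ v, Fin (μ v)} (h1 : x.1 = y.1)
    (h2 : dotPos x = dotPos y) : x = y := by
  obtain ⟨v, j⟩ := x
  obtain ⟨v', j'⟩ := y
  obtain rfl : v = v' := h1
  obtain rfl : j = j' := Fin.ext h2
  rfl

theorem stdPerm_apply_fst {V : Type} {μ : V → ℕ} (x : Σ v, Fin (μ v)) : (stdPerm μ x).1 = x.1 :=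
  rfl

theorem dotPos_stdPerm {V : Type} {μ : V → ℕ} (x : Σ v, Fin (μ v)) :
    dotPos (stdPerm μ x) = if dotPos x + 1 = μ x.1 then 0 else dotPos x + 1 := by
  obtain ⟨v, j⟩ := x
  change (finRotate (μ v) j : ℕ) = if (j : ℕ) + 1 = μ v then 0 else (j : ℕ) + 1
  have := j.neZero
  rw [finRotate_apply, Fin.val_add]
  simp only [Fin.val_one', Nat.add_mod_mod]
  have hj := j.2
  split_ifs with h
  · rw [h, Nat.mod_self]
  · exact Nat.mod_eq_of_lt (by omega)

section Separate

variable {V : Type} [DecidableEq V] {ν : V → ℕ}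

/-- The dots with label in `B` and the other dots. -/
noncomputable def sigmaSeparate (ν : V → ℕ) (B : Finset V) :
    (Σ v : {v // v ∈ B}, Fin (ν v)) ⊕ (Σ v : {v // v ∉ B}, Fin (ν v)) ≃ Σ v, Fin (ν v) :=
  Equiv.ofBijective (Sum.elim (fun x => ⟨x.1, x.2⟩) fun x => ⟨x.1, x.2⟩) (by
    constructor
    · rintro (⟨⟨v, hv⟩, j⟩ | ⟨⟨v, hv⟩, j⟩) (⟨⟨v', hv'⟩, j'⟩ | ⟨⟨v', hv'⟩, j'⟩) h
      · obtain rfl : v = v' := congrArg Sigma.fst h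
        simpa using h
      · obtain rfl : v = v' := congrArg Sigma.fst h
        exact absurd hv hv'
      · obtain rfl : v = v' := congrArg Sigma.fst h
        exact absurd hv' hv
      · obtain rfl : v = v' := congrArg Sigma.fst h
        simpa using h
    · rintro ⟨v, j⟩
      by_cases hv : v ∈ B
      · exact ⟨Sum.inl ⟨⟨v, hv⟩, j⟩, rfl⟩
      · exact ⟨Sum.inr ⟨⟨v, hv⟩, j⟩, rfl⟩)

theorem sigmaSeparate_semiconj (B : Finset V) :
    Function.Semiconj (sigmaSeparate ν B)
      (sumCongr (stdPerm fun v : {v // v ∈ B} => ν v) (stdPerm fun v : {v // v ∉ B} => ν v))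
      (stdPerm ν) := by
  rintro (x | x) <;> rfl

/-- The list consists of a factorization on the dots with label in `B` and one on the others. -/
def SplitsAt (r : ℕ) (ν : V → ℕ) (B : Finset V)
    (l : List ((Σ v, Fin (ν v)) × (Σ v, Fin (ν v)))) : Prop :=
  ∃ l', l = l'.map (Prod.map (sigmaSeparate ν B) (sigmaSeparate ν B) ∘ pairIncl) ∧
    IsFactorization r (stdPerm fun v : {v // v ∈ B} => ν v) (lefts l') ∧
    IsFactorization r (stdPerm fun v : {v // v ∉ B} => ν v) (rights l')

variable {r : ℕ} {B : Finset V} {l : List ((Σ v, Fin (ν v)) × (Σ v, Fin (ν v)))}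
  {a b : Σ v, Fin (ν v)}

theorem card_splitsAt [Fintype V] (r : ℕ) (ν : V → ℕ) (B : Finset V) (s : ℕ) :
    Nat.card {w : Fin s → (Σ v, Fin (ν v)) × (Σ v, Fin (ν v)) // SplitsAt r ν B (List.ofFn w)} =
      ∑ p ∈ Finset.HasAntidiagonal.antidiagonal s, s.choose p.1 *
        (numFactorizations r (stdPerm fun v : {v // v ∈ B} => ν v) p.1 *
          numFactorizations r (stdPerm fun v : {v // v ∉ B} => ν v) p.2) := by
  classical
  unfold SplitsAt
  rw [natCard_exists_map (((sigmaSeparate ν B).injective.prodMap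
    (sigmaSeparate ν B).injective).comp pairIncl_injective) fun l' =>
    IsFactorization r (stdPerm fun v : {v // v ∈ B} => ν v) (lefts l') ∧
    IsFactorization r (stdPerm fun v : {v // v ∉ B} => ν v) (rights l'),
    natCard_subtype_eq_sum]
  simp only [numFactorizations, natCard_subtype_eq_sum]
  rw [← sum_shuffle s
    (fun l => if IsFactorization r (stdPerm fun v : {v // v ∈ B} => ν v) l then 1 else 0)
    (fun l => if IsFactorization r (stdPerm fun v : {v // v ∉ B} => ν v) l then 1 else 0)]
  refine Finset.sum_congr rfl fun w _ => ?_
  split_ifs <;> simp_all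

theorem SplitsAt.isBridged (h : SplitsAt r ν B l) (ha : a.1 ∈ B) (hb : b.1 ∉ B) :
    IsBridged r (stdPerm ν) a b l := by
  obtain ⟨l', rfl, h1⟩ := h
  have := (isBridged_sum (a := ⟨⟨a.1, ha⟩, a.2⟩) (b := ⟨⟨b.1, hb⟩, b.2⟩)).2 h1
  rw [← List.map_map]
  exact this.semiconj (sigmaSeparate_semiconj B)

theorem SplitsAt.fst_mem_iff (h : SplitsAt r ν B l) : ∀ p ∈ l, p.1.1 ∈ B ↔ p.2.1 ∈ B := by
  obtain ⟨l', rfl, -⟩ := h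
  intro p hp
  obtain ⟨q, -, rfl⟩ := List.mem_map.1 hp
  rcases q with ⟨x, y⟩ | ⟨x, y⟩
  · exact iff_of_true x.1.2 y.1.2
  · exact iff_of_false x.1.2 y.1.2

theorem SplitsAt.not_isFactorization (h : SplitsAt r ν B l) (ha : a.1 ∈ B) (hb : b.1 ∉ B) :
    ¬ IsFactorization r (stdPerm ν) l :=
  fun hf => hb (hf.trans {x | x.1 ∈ B} (fun _ => Iff.rfl) h.fst_mem_iff a ha b)

/-- The part on `B` is transitive and `B'` contains `a`, so `B ⊆ B'`; the part on the complement is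
transitive and `B'` misses `b`, so the complements are nested as well. -/
theorem SplitsAt.unique (hν : ∀ v, 0 < ν v) {B' : Finset V} (h : SplitsAt r ν B l)
    (h' : ∀ p ∈ l, p.1.1 ∈ B' ↔ p.2.1 ∈ B') (ha : a.1 ∈ B) (hb : b.1 ∉ B)
    (ha' : a.1 ∈ B') (hb' : b.1 ∉ B') : B = B' := by
  obtain ⟨l', rfl, h1, h2⟩ := h
  rw [List.forall_mem_map] at h'
  ext v
  constructor
  · intro hv
    exact h1.trans {x | x.1.1 ∈ B'} (fun _ => Iff.rfl) (fun p hp => h' _ (mem_lefts.1 hp))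
      ⟨⟨a.1, ha⟩, a.2⟩ ha' ⟨⟨v, hv⟩, ⟨0, hν v⟩⟩
  · intro hv
    by_contra hvB
    exact h2.trans {x | x.1.1 ∉ B'} (fun _ => Iff.rfl)
      (fun p hp => not_congr (h' _ (mem_rights.1 hp)))
      ⟨⟨b.1, hb⟩, b.2⟩ hb' ⟨⟨v, hvB⟩, ⟨0, hν v⟩⟩ hv

/-- Failure of transitivity gives an invariant set that separates `a` from `b`, since otherwise the
bridge would not help. It is a union of cycles, hence given by a set `B` of labels, and no pair
crosses its boundary. -/
theorem IsBridged.exists_splitsAt [Fintype V] (h : IsBridged r (stdPerm ν) a b l)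
    (hl : ¬ IsFactorization r (stdPerm ν) l) :
    ∃ B : Finset V, (a.1 ∈ B ∧ b.1 ∉ B) ∧ SplitsAt r ν B l := by
  classical
  obtain ⟨A, hA, hAl, ha, hb⟩ : ∃ A : Set (Σ v, Fin (ν v)), (∀ x, stdPerm ν x ∈ A ↔ x ∈ A) ∧
      (∀ p ∈ l, p.1 ∈ A ↔ p.2 ∈ A) ∧ a ∈ A ∧ b ∉ A := by
    have h1 : ¬ JointlyTransitive (stdPerm ν) l := fun h2 => hl ⟨h.ne, h2, h.cycles⟩
    unfold JointlyTransitive at h1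
    push Not at h1
    obtain ⟨A, hA, hAl, x, hx, y, hy⟩ := h1
    have hab : ¬ (a ∈ A ↔ b ∈ A) := fun hab => hy (h.trans A hA
      (by simp only [List.mem_cons, forall_eq_or_imp]; exact ⟨hab, hAl⟩) x hx y)
    -- The complement is just as invariant, so `a` may be taken to lie inside.
    by_cases ha : a ∈ A
    · exact ⟨A, hA, hAl, ha, by tauto⟩
    · exact ⟨Aᶜ, fun x => not_congr (hA x), fun p hp => not_congr (hAl p hp), ha, by simp; tauto⟩
  have hmem : ∀ x : Σ v, Fin (ν v), x ∈ A ↔ ∃ j, (⟨x.1, j⟩ : Σ v, Fin (ν v)) ∈ A := fun x =>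
    ⟨fun hx => ⟨x.2, hx⟩, fun ⟨j, hj⟩ => (mem_iff_of_sameCycle hA
      (x := ⟨x.1, j⟩) (y := x) (stdPerm_sameCycle_iff.2 rfl)).1 hj⟩
  set B : Finset V := Finset.univ.filter fun v => ∃ j, (⟨v, j⟩ : Σ v, Fin (ν v)) ∈ A with hB
  have hAB : ∀ x : Σ v, Fin (ν v), x ∈ A ↔ x.1 ∈ B := fun x => by rw [hmem, hB]; simp
  have ha' := (hAB a).1 ha
  have hb' := fun hb' => hb ((hAB b).2 hb')
  have hrange : l ∈ Set.range (List.map fun p =>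
      Prod.map (sigmaSeparate ν B) (sigmaSeparate ν B) (pairIncl p)) := by
    rw [Set.range_list_map]
    intro p hp
    have := hAl p hp
    rw [hAB, hAB] at this
    by_cases h1 : p.1.1 ∈ B
    · exact ⟨Sum.inl (⟨⟨p.1.1, h1⟩, p.1.2⟩, ⟨⟨p.2.1, this.1 h1⟩, p.2.2⟩), rfl⟩
    · exact ⟨Sum.inr (⟨⟨p.1.1, h1⟩, p.1.2⟩, ⟨⟨p.2.1, fun h2 => h1 (this.2 h2)⟩, p.2.2⟩), rfl⟩
  obtain ⟨l', rfl⟩ := hrange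
  refine ⟨B, ⟨ha', hb'⟩, l', rfl, ?_⟩
  refine (isBridged_sum (a := ⟨⟨a.1, ha'⟩, a.2⟩) (b := ⟨⟨b.1, hb'⟩, b.2⟩)).1 ?_
  rw [← isBridged_semiconj_iff (sigmaSeparate_semiconj B), List.map_map]
  exact h

/-- Either the pairs are transitive without the bridge, or there is a unique separating set of
labels containing that of `a`; the binomial coefficient counts the shuffles of the two parts. -/
theorem numBridged_eq [Fintype V] (hν : ∀ v, 0 < ν v) (r s : ℕ) :
    numBridged r (stdPerm ν) a b s = numFactorizations r (stdPerm ν) s +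
      ∑ B ∈ Finset.univ.filter (fun B : Finset V => a.1 ∈ B ∧ b.1 ∉ B),
        ∑ p ∈ Finset.HasAntidiagonal.antidiagonal s, s.choose p.1 *
          (numFactorizations r (stdPerm fun v : {v // v ∈ B} => ν v) p.1 *
            numFactorizations r (stdPerm fun v : {v // v ∉ B} => ν v) p.2) := by
  classical
  simp only [← card_splitsAt]
  rw [numBridged, numFactorizations]
  simp only [natCard_subtype_eq_sum]
  rw [Finset.sum_comm, ← Finset.sum_add_distrib]
  refine Finset.sum_congr rfl fun w _ => ?_
  by_cases hf : IsFactorization r (stdPerm ν) (List.ofFn w)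
  · have hbr : IsBridged r (stdPerm ν) a b (List.ofFn w) := ⟨hf.ne, hf.trans.cons _, hf.cycles⟩
    rw [if_pos hbr, if_pos hf, Finset.sum_eq_zero, add_zero]
    intro B hB
    rw [Finset.mem_filter] at hB
    exact if_neg fun h => h.not_isFactorization hB.2.1 hB.2.2 hf
  · rw [if_neg hf, zero_add]
    by_cases hbr : IsBridged r (stdPerm ν) a b (List.ofFn w)
    · obtain ⟨B, hB, hs⟩ := hbr.exists_splitsAt hf
      rw [if_pos hbr, Finset.sum_eq_single_of_mem B (by simpa using hB), if_pos hs]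
      intro B' hB' hne
      rw [Finset.mem_filter] at hB'
      exact if_neg fun h => hne (h.unique hν hs.fst_mem_iff hB'.2.1 hB'.2.2 hB.1 hB.2)
    · rw [if_neg hbr, Finset.sum_eq_zero]
      intro B hB
      rw [Finset.mem_filter] at hB
      exact if_neg fun h => hbr (h.isBridged hB.2.1 hB.2.2)

end Separate

/-! ### Gluing two cycles into one -/

section Reindex

variable {V V' : Type} [DecidableEq V] [DecidableEq V']

theorem numFactorizations_reindex {μ : V → ℕ} {μ' : V' → ℕ} (f : V → V')
    (hf : Function.Bijective f) (h : ∀ v, μ' (f v) = μ v) (r s : ℕ) :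
    numFactorizations r (stdPerm μ) s = numFactorizations r (stdPerm μ') s := by
  obtain rfl : μ' ∘ f = μ := funext h
  exact numFactorizations_semiconj
    (e := sigmaCongrLeft (β := fun v => Fin (μ' v)) (Equiv.ofBijective f hf)) (fun _ => rfl) r s

/-- The last dot of the cycle of `v`. -/
def lastDot {V : Type} {μ : V → ℕ} (hμ : ∀ v, 0 < μ v) (v : V) : Σ v, Fin (μ v) :=
  ⟨v, ⟨μ v - 1, Nat.sub_one_lt (hμ v).ne'⟩⟩

/-- The standard permutation with the cycles of `u'` and `u` glued to one cycle, the
cycle of `i`: it changes by the transposition of the two last dots. -/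
theorem exists_glue {ν : V' → ℕ} {μ : V → ℕ} (hν : ∀ v, 0 < ν v)
    (q : V' → V) {u u' : V'} {i : V} (huu' : u ≠ u') (hu : q u = i) (hu' : q u' = i)
    (hqi : ∀ v, v ≠ u → v ≠ u' → q v ≠ i) (hqμ : ∀ v, v ≠ u → v ≠ u' → μ (q v) = ν v)
    (hinj : ∀ v w, q v = q w → q v ≠ i → v = w) (hsurj : ∀ k, k ≠ i → ∃ v, q v = k)
    (hi : μ i = ν u' + ν u) :
    ∃ e : (Σ v, Fin (ν v)) ≃ Σ v, Fin (μ v),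
      ((e (lastDot hν u)).1 = i ∧ dotPos (e (lastDot hν u)) + 1 = μ i) ∧
      ((e (lastDot hν u')).1 = i ∧ dotPos (e (lastDot hν u')) + 1 = ν u') ∧
      Function.Semiconj e (stdPerm ν)
        (stdPerm μ * swap (e (lastDot hν u)) (e (lastDot hν u'))) := by
  -- The glued cycle runs through the dots of `u'` and then those of `u`, whose positions are
  -- shifted by `ν u'`.
  have hlt : ∀ x : Σ v, Fin (ν v), (if x.1 = u then ν u' else 0) + dotPos x < μ (q x.1) := by
    intro x
    have hj := dotPos_lt x
    generalize hv : x.1 = v at hj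
    split_ifs with h
    · subst h; rw [hu, hi]; omega
    · by_cases h' : v = u'
      · subst h'; rw [hu', hi]; omega
      · rw [hqμ v h h']; omega
  let f : (Σ v, Fin (ν v)) → Σ v, Fin (μ v) := fun x => ⟨q x.1, ⟨_, hlt x⟩⟩
  have hf1 : ∀ x, (f x).1 = q x.1 := fun x => rfl
  have hf2 : ∀ x, dotPos (f x) = (if x.1 = u then ν u' else 0) + dotPos x := fun x => rfl
  have hbij : Function.Bijective f := by
    constructor
    · intro x y h
      have h1 : q x.1 = q y.1 := congrArg Sigma.fst h
      have h2 : dotPos (f x) = dotPos (f y) := by rw [h]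
      rw [hf2, hf2] at h2
      have hx := dotPos_lt x
      have hy := dotPos_lt y
      by_cases hq : q x.1 = i
      · have hx' : x.1 = u ∨ x.1 = u' := by
          by_contra! hc
          exact hqi _ hc.1 hc.2 hq
        have hy' : y.1 = u ∨ y.1 = u' := by
          by_contra! hc
          exact hqi _ hc.1 hc.2 (h1 ▸ hq)
        rcases hx' with hx' | hx' <;> rcases hy' with hy' | hy'
        · refine dot_ext (hx'.trans hy'.symm) ?_
          simpa [hx', hy'] using h2
        · have : ν y.1 = ν u' := by rw [hy']
          simp only [hx', hy', if_true, huu'.symm, if_false] at h2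
          omega
        · have : ν x.1 = ν u' := by rw [hx']
          simp only [hx', hy', if_true, huu'.symm, if_false] at h2
          omega
        · refine dot_ext (hx'.trans hy'.symm) ?_
          simpa [hx', hy', huu'.symm] using h2
      · have h3 := hinj _ _ h1 hq
        refine dot_ext h3 ?_
        rw [h3] at h2
        omega
    · intro y
      have hy := dotPos_lt y
      by_cases hq : y.1 = i
      · rw [hq] at hy
        by_cases hj : dotPos y < ν u'
        · refine ⟨⟨u', ⟨dotPos y, hj⟩⟩, dot_ext (hu'.trans hq.symm) ?_⟩
          rw [hf2]
          simp [huu'.symm]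
        · refine ⟨⟨u, ⟨dotPos y - ν u', by omega⟩⟩, dot_ext (hu.trans hq.symm) ?_⟩
          rw [hf2]
          simp only [if_true, dotPos_mk]
          omega
      · obtain ⟨v, hv⟩ := hsurj _ hq
        have h1 : v ≠ u := fun h => hq (by rw [← hv, h, hu])
        have h2 : v ≠ u' := fun h => hq (by rw [← hv, h, hu'])
        refine ⟨⟨v, ⟨dotPos y, by rw [← hqμ v h1 h2, hv]; exact dotPos_lt y⟩⟩, dot_ext hv ?_⟩
        rw [hf2]
        simp [h1]
  have hpu := hν u
  have hpu' := hν u'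
  have hlast : ∀ v, (lastDot hν v).1 = v := fun v => rfl
  have hlast2 : ∀ v, dotPos (lastDot hν v) = ν v - 1 := fun v => rfl
  refine ⟨Equiv.ofBijective f hbij, ⟨hu, ?_⟩, ⟨hu', ?_⟩, ?_⟩
  · change dotPos (f _) + 1 = _
    rw [hf2, hlast, hlast2, if_pos rfl]
    omega
  · change dotPos (f _) + 1 = _
    rw [hf2, hlast, hlast2, if_neg huu'.symm]
    omega
  -- The successor changes only at the two last dots: in the glued cycle each is followed by the
  -- first dot of the other piece, and the transposition corrects this.
  · intro x
    change f (stdPerm ν x) = stdPerm μ (swap (f (lastDot hν u)) (f (lastDot hν u')) (f x))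
    by_cases hxu : x = lastDot hν u
    · rw [hxu, swap_apply_left]
      refine dot_ext (by simp only [hf1, stdPerm_apply_fst, hlast, hu, hu']) ?_
      rw [hf2, dotPos_stdPerm, dotPos_stdPerm, stdPerm_apply_fst, hf1, hf2]
      simp only [hlast, hlast2, if_true, huu'.symm, if_false, hu', hi]
      split_ifs <;> omega
    · by_cases hxu' : x = lastDot hν u'
      · rw [hxu', swap_apply_right]
        refine dot_ext (by simp only [hf1, stdPerm_apply_fst, hlast, hu, hu']) ?_
        rw [hf2, dotPos_stdPerm, dotPos_stdPerm, stdPerm_apply_fst, hf1, hf2]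
        simp only [hlast, hlast2, if_true, huu'.symm, if_false, hu, hi]
        split_ifs <;> omega
      · rw [swap_apply_of_ne_of_ne (hbij.1.ne hxu) (hbij.1.ne hxu')]
        refine dot_ext rfl ?_
        rw [hf2, dotPos_stdPerm, dotPos_stdPerm, stdPerm_apply_fst, hf1, hf2]
        have hx := dotPos_lt x
        by_cases h1 : x.1 = u
        · have h2 : dotPos x ≠ ν u - 1 := fun h => hxu (dot_ext h1 h)
          rw [h1] at hx
          simp only [h1, if_true, hu, hi]
          split_ifs <;> omega
        · by_cases h2 : x.1 = u'
          · have h3 : dotPos x ≠ ν u' - 1 := fun h => hxu' (dot_ext h2 h)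
            rw [h2] at hx
            simp only [h2, huu'.symm, if_false, hu', hi]
            split_ifs <;> omega
          · simp only [h1, if_false, hqμ _ h1 h2]
            split_ifs <;> omega

end Reindex

/-! ### Normalizing the first pair by rotating the cycles -/

section CutJoin

variable {V : Type} {μ : V → ℕ}

theorem finRotate_last_eq {n : ℕ} (h : 0 < n) :
    finRotate n ⟨n - 1, Nat.sub_one_lt h.ne'⟩ = ⟨0, h⟩ := by
  obtain ⟨m, rfl⟩ : ∃ m, n = m + 1 := ⟨n - 1, by omega⟩
  exact finRotate_last

/-- The cycles of the standard permutation can be rotated independently. -/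
theorem exists_rotation (hμ : ∀ v, 0 < μ v) (c : ∀ v, Fin (μ v)) :
    ∃ ρ : ∀ v, Perm (Fin (μ v)), Function.Semiconj (sigmaCongrRight ρ) (stdPerm μ) (stdPerm μ) ∧
      ∀ v, sigmaCongrRight ρ (lastDot hμ v) = ⟨v, c v⟩ := by
  refine ⟨fun v => finRotate (μ v) ^ ((c v : ℕ) + 1), ?_, fun v => ?_⟩
  · rintro ⟨v, j⟩
    change (⟨v, (finRotate (μ v) ^ ((c v : ℕ) + 1)) (finRotate (μ v) j)⟩ : Σ v, Fin (μ v)) =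
      ⟨v, finRotate (μ v) ((finRotate (μ v) ^ ((c v : ℕ) + 1)) j)⟩
    rw [← Perm.mul_apply, ← Perm.mul_apply, ← pow_succ, ← pow_succ']
  · change (⟨v, (finRotate (μ v) ^ ((c v : ℕ) + 1)) ⟨μ v - 1, Nat.sub_one_lt (hμ v).ne'⟩⟩ :
      Σ v, Fin (μ v)) = _
    rw [pow_succ, Perm.mul_apply, finRotate_last_eq (hμ v), finRotate_pow_zero]

variable [DecidableEq V]

/-- The number of factorizations that begin with the pair `(a, b)`. -/
noncomputable def numBeginning (r : ℕ) (μ : V → ℕ) (a b : Σ v, Fin (μ v)) (s : ℕ) : ℕ :=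
  if a = b then 0 else numBridged r (stdPerm μ * swap a b) a b s

theorem numBeginning_semiconj {f : Perm (Σ v, Fin (μ v))}
    (hf : Function.Semiconj f (stdPerm μ) (stdPerm μ)) (r : ℕ) (a b : Σ v, Fin (μ v)) (s : ℕ) :
    numBeginning r μ (f a) (f b) s = numBeginning r μ a b s := by
  unfold numBeginning
  rw [numBridged_semiconj (semiconj_mul_swap f.injective hf a b) r a b s]
  simp only [f.injective.eq_iff]

/-- Dots on different cycles can be rotated to the last positions independently, so all `μ i * μ j`
choices contribute equally. -/
theorem numBeginning_of_ne (hμ : ∀ v, 0 < μ v) (r : ℕ) {i j : V} (hij : i ≠ j)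
    (x : Fin (μ i)) (y : Fin (μ j)) (s : ℕ) :
    numBeginning r μ ⟨i, x⟩ ⟨j, y⟩ s = numBeginning r μ (lastDot hμ i) (lastDot hμ j) s := by
  obtain ⟨ρ, hρ, hρ'⟩ := exists_rotation hμ
    (Function.update (Function.update (fun v => ⟨0, hμ v⟩) i x) j y)
  rw [← numBeginning_semiconj hρ (a := lastDot hμ i), hρ', hρ']
  simp [hij]

/-- On a single cycle only the first dot of the pair can be normalized. The distance to the second
remains free and becomes the size of a piece of the cut cycle. -/
theorem sum_numBeginning_self (hμ : ∀ v, 0 < μ v) (r : ℕ) (i : V) (s : ℕ) :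
    ∑ x, ∑ y, numBeginning r μ ⟨i, x⟩ ⟨i, y⟩ s =
      μ i * ∑ y, numBeginning r μ (lastDot hμ i) ⟨i, y⟩ s := by
  have h : ∀ x, ∑ y, numBeginning r μ ⟨i, x⟩ ⟨i, y⟩ s =
      ∑ y, numBeginning r μ (lastDot hμ i) ⟨i, y⟩ s := by
    intro x
    obtain ⟨ρ, hρ, hρ'⟩ := exists_rotation hμ (Function.update (fun v => ⟨0, hμ v⟩) i x)
    rw [← Equiv.sum_comp (ρ i)]
    refine Finset.sum_congr rfl fun y _ => ?_
    rw [← numBeginning_semiconj hρ (a := lastDot hμ i), hρ']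
    simp
  simp [h]

theorem numFactorizations_stdPerm_succ [Fintype V] (hμ : ∀ v, 0 < μ v) (r s : ℕ) :
    numFactorizations r (stdPerm μ) (s + 1) =
      ∑ i, (∑ j ∈ Finset.univ.erase i,
        μ i * μ j * numBeginning r μ (lastDot hμ i) (lastDot hμ j) s) +
      ∑ i, μ i * ∑ y, numBeginning r μ (lastDot hμ i) ⟨i, y⟩ s := by
  have h : ∀ i, ∑ x, ∑ b : Σ v, Fin (μ v), numBeginning r μ ⟨i, x⟩ b s =
      (∑ j ∈ Finset.univ.erase i, μ i * μ j * numBeginning r μ (lastDot hμ i) (lastDot hμ j) s) +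
      μ i * ∑ y, numBeginning r μ (lastDot hμ i) ⟨i, y⟩ s := by
    intro i
    rw [← sum_numBeginning_self]
    simp only [Fintype.sum_sigma]
    rw [Finset.sum_comm, ← Finset.sum_erase_add _ _ (Finset.mem_univ i)]
    congr 1
    refine Finset.sum_congr rfl fun j hj => ?_
    simp only [numBeginning_of_ne hμ r (Finset.ne_of_mem_erase hj).symm]
    simp [mul_assoc]
  rw [numFactorizations_succ, Fintype.sum_sigma, ← Finset.sum_add_distrib]
  exact Finset.sum_congr rfl fun i _ => h i

end CutJoin

/-! ### The cut-and-join recursion for numbers of factorizations -/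

section Fin

variable {n : ℕ} {μ : Fin n → ℕ}

theorem merge_pos (hμ : ∀ v, 0 < μ v) (i j : Fin n) (k) : 0 < merge μ i j k := by
  unfold merge
  have := hμ i
  have := hμ k
  split_ifs <;> omega

theorem split_pos (hμ : ∀ v, 0 < μ v) (i : Fin n) {α β : ℕ} (hα : 0 < α) (hβ : 0 < β) (k) :
    0 < split μ i α β k := by
  rcases k with _ | _ | k
  exacts [hα, hβ, hμ k]

theorem consOn_pos (hμ : ∀ v, 0 < μ v) {α : ℕ} (hα : 0 < α) (I : Finset (Fin n)) (k) :
    0 < consOn α μ I k := by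
  rcases k with _ | k
  exacts [hα, hμ k]

/-- A transposition of dots of different vertices joins the two cycles. -/
theorem numBeginning_eq_merge (hμ : ∀ v, 0 < μ v) (r : ℕ) {i j : Fin n} (hij : i ≠ j) (s : ℕ) :
    numBeginning r μ (lastDot hμ i) (lastDot hμ j) s =
      numFactorizations r (stdPerm (merge μ i j)) s := by
  obtain ⟨e, ⟨he1, -⟩, ⟨he2, -⟩, he⟩ := exists_glue (μ := merge μ i j) hμ
    (fun k => if h : k = j then ⟨i, hij⟩ else ⟨k, h⟩) (i := ⟨i, hij⟩) hij (by simp [hij])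
    (by simp) (fun v hi hj => by simp [hi, hj]) (fun v hi hj => by simp [hi, hj, merge])
    (fun v w => by
      intro h1 h2
      by_cases hv : v = j
      · simp [hv] at h2
      · by_cases hw : w = j
        · simp [hv, hw] at h1 h2
          exact absurd h1 h2
        · simpa [hv, hw] using h1)
    (fun k hk => ⟨k, by simp [k.2]⟩) (by simp [merge, add_comm])
  -- Gluing is the inverse of cutting: multiplying both sides by the transposition moves it to the
  -- unglued permutation.
  have he' := semiconj_mul_swap e.injective he (lastDot hμ i) (lastDot hμ j)
  rw [mul_assoc, swap_mul_self, mul_one] at he'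
  have hne : lastDot hμ i ≠ lastDot hμ j := fun h => hij (congrArg Sigma.fst h)
  rw [numBeginning, if_neg hne, numBridged_semiconj he', numBridged_of_sameCycle]
  rw [stdPerm_sameCycle_iff, he1, he2]

/-- A transposition of dots of the same vertex cuts the cycle. -/
theorem numBeginning_eq_split (hμ : ∀ v, 0 < μ v) (r : ℕ) (i : Fin n) {α β : ℕ} (hα : 0 < α)
    (hβ : 0 < β) (hαβ : α + β = μ i) (y : Fin (μ i)) (hy : (y : ℕ) + 1 = β) (s : ℕ) :
    numBeginning r μ (lastDot hμ i) ⟨i, y⟩ s =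
      numBridged r (stdPerm (split μ i α β)) (lastDot (split_pos hμ i hα hβ) none)
        (lastDot (split_pos hμ i hα hβ) (some none)) s := by
  obtain ⟨e, ⟨he1, he1'⟩, ⟨he2, he2'⟩, he⟩ := exists_glue (μ := μ) (split_pos hμ i hα hβ)
    (fun k => match k with
      | none => i
      | some none => i
      | some (some k) => k) (u := none) (u' := some none) (i := i) (by simp) rfl rfl
    (fun v h1 h2 => by
      rcases v with _ | _ | v
      · exact absurd rfl h1
      · exact absurd rfl h2
      · exact v.2)
    (fun v h1 h2 => by
      rcases v with _ | _ | v
      · exact absurd rfl h1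
      · exact absurd rfl h2
      · rfl)
    (fun v w h1 h2 => by
      rcases v with _ | _ | v
      · exact absurd rfl h2
      · exact absurd rfl h2
      · rcases w with _ | _ | w
        · exact absurd h1 h2
        · exact absurd h1 h2
        · rw [Subtype.ext h1])
    (fun k hk => ⟨some (some ⟨k, hk⟩), rfl⟩) (by simp only [split]; omega)
  have h1 : e (lastDot (split_pos hμ i hα hβ) none) = lastDot hμ i := by
    refine dot_ext he1 ?_
    have : dotPos (lastDot hμ i) = μ i - 1 := rfl
    omega
  have h2 : e (lastDot (split_pos hμ i hα hβ) (some none)) = ⟨i, y⟩ := by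
    refine dot_ext he2 ?_
    change _ = β at he2'
    change _ = (y : ℕ)
    omega
  rw [h1, h2] at he
  have hne : lastDot hμ i ≠ ⟨i, y⟩ := by
    intro h
    have : μ i - 1 = y := congrArg dotPos h
    omega
  rw [numBeginning, if_neg hne, numBridged_semiconj he, h1, h2]

/-- The labels in the part of a cut tuple that contains the first piece. -/
def splitLabels (i : Fin n) (I : Finset (Fin n)) : Finset (Option (Option {k : Fin n // k ≠ i})) :=
  Finset.univ.filter fun x => (match x with
    | none => true
    | some none => false
    | some (some k) => decide ((k : Fin n) ∈ I)) = true

theorem none_mem_splitLabels (i : Fin n) (I : Finset (Fin n)) : none ∈ splitLabels i I := by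
  simp [splitLabels]

theorem some_none_notMem_splitLabels (i : Fin n) (I : Finset (Fin n)) :
    some none ∉ splitLabels i I := by
  simp [splitLabels]

theorem some_some_mem_splitLabels (i : Fin n) (I : Finset (Fin n)) (k : {k : Fin n // k ≠ i}) :
    some (some k) ∈ splitLabels i I ↔ (k : Fin n) ∈ I := by
  simp [splitLabels]

theorem numFactorizations_splitLabels (μ : Fin n → ℕ) (i : Fin n) (I : Finset (Fin n))
    (hI : i ∉ I) (α β r s : ℕ) :
    numFactorizations r (stdPerm fun v : {v // v ∈ splitLabels i I} => split μ i α β v) s =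
      numFactorizations r (stdPerm (consOn α μ I)) s := by
  symm
  refine numFactorizations_reindex (fun k => match k with
    | none => ⟨none, none_mem_splitLabels i I⟩
    | some k => ⟨some (some ⟨k, fun h => hI (h ▸ k.2)⟩),
        (some_some_mem_splitLabels i I _).2 k.2⟩) ⟨?_, ?_⟩ ?_ r s
  · rintro (_ | ⟨k, hk⟩) (_ | ⟨k', hk'⟩) h <;> simp_all
  · rintro ⟨_ | _ | k, hv⟩
    · exact ⟨none, rfl⟩
    · exact absurd hv (some_none_notMem_splitLabels i I)
    · exact ⟨some ⟨k, (some_some_mem_splitLabels i I k).1 hv⟩, rfl⟩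
  · rintro (_ | k) <;> rfl

theorem numFactorizations_compl_splitLabels (μ : Fin n → ℕ) (i : Fin n) (I : Finset (Fin n))
    (α β r s : ℕ) :
    numFactorizations r (stdPerm fun v : {v // v ∉ splitLabels i I} => split μ i α β v) s =
      numFactorizations r (stdPerm (consOn β μ (Finset.univ.erase i \ I))) s := by
  symm
  refine numFactorizations_reindex (fun k => match k with
    | none => ⟨some none, some_none_notMem_splitLabels i I⟩
    | some k => ⟨some (some ⟨k, Finset.ne_of_mem_erase (Finset.mem_sdiff.1 k.2).1⟩),
        fun h => (Finset.mem_sdiff.1 k.2).2 ((some_some_mem_splitLabels i I _).1 h)⟩)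
    ⟨?_, ?_⟩ ?_ r s
  · rintro (_ | ⟨k, hk⟩) (_ | ⟨k', hk'⟩) h <;> simp_all
  · rintro ⟨_ | _ | k, hv⟩
    · exact absurd (none_mem_splitLabels i I) hv
    · exact ⟨none, rfl⟩
    · refine ⟨some ⟨k, ?_⟩, rfl⟩
      rw [some_some_mem_splitLabels] at hv
      simp [hv, k.2]
  · rintro (_ | k) <;> rfl

/-- A set of labels containing the piece `α` but not `β` is determined by its other elements, which
form an arbitrary subset of the vertices other than `i`. -/
theorem sum_splitLabels (i : Fin n) (F : Finset (Option (Option {k : Fin n // k ≠ i})) → ℕ) :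
    ∑ B ∈ Finset.univ.filter (fun B => none ∈ B ∧ some none ∉ B), F B =
      ∑ I ∈ (Finset.univ.erase i).powerset, F (splitLabels i I) := by
  symm
  refine Finset.sum_bij (fun I _ => splitLabels i I) (fun I _ => ?_) (fun I hI I' hI' h => ?_)
    (fun B hB => ?_) (fun _ _ => rfl)
  · simp [none_mem_splitLabels, some_none_notMem_splitLabels]
  · rw [Finset.mem_powerset] at hI hI'
    ext k
    by_cases hk : k = i
    · subst hk
      exact iff_of_false (fun h => by simpa using hI h) fun h => by simpa using hI' h
    · rw [← some_some_mem_splitLabels i I ⟨k, hk⟩, h, some_some_mem_splitLabels]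
  · simp only [Finset.mem_filter, Finset.mem_univ, true_and] at hB
    refine ⟨(Finset.univ.erase i).filter fun k => ∃ h : k ≠ i, some (some ⟨k, h⟩) ∈ B,
      Finset.mem_powerset.2 (Finset.filter_subset _ _), ?_⟩
    ext x
    rcases x with _ | _ | k
    · exact iff_of_true (none_mem_splitLabels _ _) hB.1
    · exact iff_of_false (some_none_notMem_splitLabels _ _) hB.2
    · rw [some_some_mem_splitLabels]
      simp [k.2]

/-- The cut-and-join recursion for the number of factorizations. -/
theorem cut_and_join (hμ : ∀ v, 0 < μ v) (r s : ℕ) :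
    numFactorizations r (stdPerm μ) (s + 1) =
      (∑ i, ∑ j ∈ Finset.univ.erase i,
        μ i * μ j * numFactorizations r (stdPerm (merge μ i j)) s) +
      ∑ i, μ i * ∑ p ∈ (Finset.HasAntidiagonal.antidiagonal (μ i)).filter
          (fun p => 1 ≤ p.1 ∧ 1 ≤ p.2),
        (numFactorizations r (stdPerm (split μ i p.1 p.2)) s +
          ∑ I ∈ (Finset.univ.erase i).powerset, ∑ q ∈ Finset.HasAntidiagonal.antidiagonal s,
            s.choose q.1 * (numFactorizations r (stdPerm (consOn p.1 μ I)) q.1 *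
              numFactorizations r (stdPerm (consOn p.2 μ (Finset.univ.erase i \ I))) q.2)) := by
  rw [numFactorizations_stdPerm_succ hμ]
  congr 1
  · refine Finset.sum_congr rfl fun i _ => Finset.sum_congr rfl fun j hj => ?_
    rw [numBeginning_eq_merge hμ r (Finset.ne_of_mem_erase hj).symm]
  · refine Finset.sum_congr rfl fun i _ => ?_
    congr 1
    have hsplit : ∀ y : Fin (μ i), (y : ℕ) + 1 ≠ μ i →
        numBeginning r μ (lastDot hμ i) ⟨i, y⟩ s =
        numFactorizations r (stdPerm (split μ i (μ i - (y + 1)) (y + 1))) s +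
          ∑ I ∈ (Finset.univ.erase i).powerset, ∑ q ∈ Finset.HasAntidiagonal.antidiagonal s,
            s.choose q.1 * (numFactorizations r (stdPerm (consOn (μ i - (y + 1)) μ I)) q.1 *
              numFactorizations r (stdPerm (consOn (y + 1) μ (Finset.univ.erase i \ I))) q.2) := by
      intro y hy
      have hy' := y.2
      have hα : 0 < μ i - (y + 1) := by omega
      have hβ : 0 < (y : ℕ) + 1 := by omega
      rw [numBeginning_eq_split hμ r i hα hβ (by omega) y rfl,
        numBridged_eq (split_pos hμ i hα hβ)]
      congr 1
      refine (sum_splitLabels i fun B => ∑ q ∈ Finset.HasAntidiagonal.antidiagonal s,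
        s.choose q.1 *
        (numFactorizations r (stdPerm fun v : {v // v ∈ B} =>
            split μ i (μ i - (y + 1)) (y + 1) v) q.1 *
          numFactorizations r (stdPerm fun v : {v // v ∉ B} =>
            split μ i (μ i - (y + 1)) (y + 1) v) q.2)).trans ?_
      refine Finset.sum_congr rfl fun I hI => Finset.sum_congr rfl fun q _ => ?_
      rw [numFactorizations_splitLabels μ i I fun h => by
        simpa using Finset.mem_powerset.1 hI h, numFactorizations_compl_splitLabels]
    -- The position `y + 1 = μ i` is the last dot itself and would give an empty piece; its term
    -- vanishes because the two dots coincide.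
    rw [← Finset.sum_filter_of_ne (p := fun y : Fin (μ i) => (y : ℕ) + 1 ≠ μ i)]
    · refine Finset.sum_bij (fun y _ => (μ i - (y + 1), (y : ℕ) + 1)) (fun y hy => ?_)
        (fun y _ y' _ h => ?_) (fun p hp => ?_) (fun y hy => ?_)
      · have := y.2
        simp only [Finset.mem_filter, Finset.mem_univ, true_and] at hy
        simp only [Finset.mem_filter, Finset.HasAntidiagonal.mem_antidiagonal]
        omega
      · have := congrArg Prod.snd h
        exact Fin.ext (by simpa using this)
      · simp only [Finset.mem_filter, Finset.HasAntidiagonal.mem_antidiagonal] at hp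
        refine ⟨⟨p.2 - 1, by omega⟩, ?_, Prod.ext ?_ ?_⟩
        · simp only [Finset.mem_filter, Finset.mem_univ, true_and]
          omega
        · simp only
          omega
        · simp only
          omega
      · exact hsplit y (by simpa using hy)
    · intro y _ hy hlast
      have h : lastDot hμ i = ⟨i, y⟩ := by
        refine dot_ext rfl ?_
        change μ i - 1 = y
        omega
      exact hy (if_pos h)

end Fin

/-! ### Numbers of dots and vertices of the derived tuples, and the Riemann-Hurwitz formula -/

section Sums

variable {n : ℕ} (μ : Fin n → ℕ)

theorem sum_merge {i j : Fin n} (hij : i ≠ j) : ∑ k, merge μ i j k = ∑ k, μ k := by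
  have h : ∑ k : {k : Fin n // k ≠ j}, merge μ i j k =
      ∑ k ∈ Finset.univ.erase j, if k = i then μ i + μ j else μ k :=
    (Finset.sum_subtype (Finset.univ.erase j) (by simp)
      fun k => if k = i then μ i + μ j else μ k).symm
  rw [h, ← Finset.add_sum_erase _ _ (Finset.mem_univ j),
    ← Finset.add_sum_erase (Finset.univ.erase j) _ (by simpa using hij : i ∈ Finset.univ.erase j),
    ← Finset.add_sum_erase (Finset.univ.erase j) μ (by simpa using hij : i ∈ Finset.univ.erase j),
    if_pos rfl]
  have h2 : ∑ k ∈ (Finset.univ.erase j).erase i, (if k = i then μ i + μ j else μ k) =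
      ∑ k ∈ (Finset.univ.erase j).erase i, μ k :=
    Finset.sum_congr rfl fun k hk => if_neg (Finset.ne_of_mem_erase hk)
  rw [h2]
  ring

theorem sum_split (i : Fin n) {α β : ℕ} (h : α + β = μ i) :
    ∑ k, split μ i α β k = ∑ k, μ k := by
  rw [Fintype.sum_option, Fintype.sum_option, ← Finset.add_sum_erase _ _ (Finset.mem_univ i), ← h,
    Finset.sum_subtype (p := fun k => k ≠ i) (Finset.univ.erase i) (by simp) μ]
  simp only [split]
  ring

theorem sum_consOn (α : ℕ) (I : Finset (Fin n)) {_ : Fintype (Option {k // k ∈ I})} :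
    ∑ k, consOn α μ I k = α + ∑ k ∈ I, μ k := by
  obtain rfl : ‹Fintype (Option {k // k ∈ I})› = instFintypeOption := Subsingleton.elim _ _
  rw [← Finset.sum_coe_sort I μ]
  exact Fintype.sum_option (consOn α μ I)

theorem card_option_mem (I : Finset (Fin n)) {_ : Fintype (Option {k // k ∈ I})} :
    Fintype.card (Option {k // k ∈ I}) = I.card + 1 := by
  obtain rfl : ‹Fintype (Option {k // k ∈ I})› = instFintypeOption := Subsingleton.elim _ _
  rw [← Fintype.card_coe I]
  exact Fintype.card_option

theorem sum_consOn_add {i : Fin n} {α β : ℕ} (h : α + β = μ i) {I : Finset (Fin n)}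
    (hI : I ⊆ Finset.univ.erase i) :
    (α + ∑ k ∈ I, μ k) + (β + ∑ k ∈ Finset.univ.erase i \ I, μ k) = ∑ k, μ k := by
  rw [← Finset.add_sum_erase _ _ (Finset.mem_univ i), ← h, ← Finset.sum_sdiff hI]
  ring

theorem card_consOn_add {i : Fin n} {I : Finset (Fin n)} (hI : I ⊆ Finset.univ.erase i) :
    (I.card + 1) + ((Finset.univ.erase i \ I).card + 1) = n + 1 := by
  have h1 := Finset.card_sdiff_add_card_eq_card hI
  have h2 := Finset.card_erase_of_mem (Finset.mem_univ i)
  rw [Finset.card_univ, Fintype.card_fin] at h2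
  have h3 := i.pos
  omega

theorem card_ne (i : Fin n) : Fintype.card {k : Fin n // k ≠ i} = n - 1 := by
  simp [Fintype.card_subtype_compl]

end Sums

theorem ne_zero_or_ne_zero_of_add {a b : ℕ} (h : a + b ≠ 0) : a ≠ 0 ∨ b ≠ 0 := by
  omega

theorem div_add_div_eq {r a b d : ℕ} (ha : r ∣ a) (h : a + b = d) : a / r + b / r = d / r := by
  rw [← h, Nat.add_div_of_dvd_right ha]

section Support

variable {V : Type} [Fintype V] [DecidableEq V] {μ : V → ℕ} {r s : ℕ}

theorem dvd_of_numFactorizations_ne_zero (h : numFactorizations r (stdPerm μ) s ≠ 0) :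
    r ∣ ∑ v, μ v := by
  obtain ⟨w, hw⟩ := (Nat.card_ne_zero.1 h).1
  simpa using hw.cycles.dvd

/-- Without transpositions `σ` alone is transitive, so it is one cycle, and this cycle has length
`r`. -/
theorem numFactorizations_zero (hr : 0 < r) [Nonempty V] (hμ : ∀ v, 0 < μ v)
    (h : numFactorizations r (stdPerm μ) 0 ≠ 0) :
    Fintype.card V = 1 ∧ (∑ v, μ v) / r = 1 := by
  obtain ⟨w, hw⟩ := (Nat.card_ne_zero.1 h).1
  rw [List.ofFn_zero] at hw
  obtain ⟨v⟩ := ‹Nonempty V›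
  have hv : ∀ v', v' = v := fun v' =>
    hw.trans {x | x.1 = v} (fun _ => Iff.rfl) (by simp) ⟨v, ⟨0, hμ v⟩⟩ rfl ⟨v', ⟨0, hμ v'⟩⟩
  refine ⟨Fintype.card_eq_one_iff.2 ⟨v, hv⟩, ?_⟩
  have h1 := hw.cycles ⟨v, ⟨0, hμ v⟩⟩
  have h2 : mulSwaps (stdPerm μ) [] = stdPerm μ := by simp [mulSwaps]
  have h3 : Nat.card {k // (stdPerm μ).SameCycle ⟨v, ⟨0, hμ v⟩⟩ k} = Nat.card (Σ v, Fin (μ v)) :=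
    Nat.card_congr (Equiv.subtypeUnivEquiv fun k => stdPerm_sameCycle_iff.2 (hv k.1).symm)
  rw [h2, h3] at h1
  have h4 : ∑ v, μ v = r := by simpa using h1
  rw [h4, Nat.div_self hr]

/-- The Riemann-Hurwitz formula, with the genus a natural number. -/
theorem exists_genus (hr : 0 < r) [Nonempty V] (hμ : ∀ v, 0 < μ v)
    (h : numFactorizations r (stdPerm μ) s ≠ 0) :
    ∃ g, s + 2 = 2 * g + (∑ v, μ v) / r + Fintype.card V := by
  induction s using Nat.strong_induction_on generalizing V with
  | _ s ih =>
  rcases s with _ | s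
  · obtain ⟨h1, h2⟩ := numFactorizations_zero hr hμ h
    exact ⟨0, by omega⟩
  -- The recursion is stated for tuples indexed by `Fin n`, while its terms are indexed by other
  -- types; the labels are therefore renumbered before each use.
  · set n := Fintype.card V with hn
    set f := (Fintype.equivFin V).symm with hf
    set ν : Fin n → ℕ := fun k => μ (f k) with hν
    have hν0 : ∀ k, 0 < ν k := fun k => hμ _
    have hsum : ∑ v, μ v = ∑ k, ν k := (f.sum_comp μ).symm
    rw [← numFactorizations_reindex (μ := ν) f f.bijective fun _ => rfl,
      cut_and_join hν0] at h
    rw [hsum]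
    rcases ne_zero_or_ne_zero_of_add h with h | h
    · obtain ⟨i, -, h⟩ := Finset.exists_ne_zero_of_sum_ne_zero h
      obtain ⟨j, hj, h⟩ := Finset.exists_ne_zero_of_sum_ne_zero h
      have hij := (Finset.ne_of_mem_erase hj).symm
      have : Nonempty {k // k ≠ j} := ⟨⟨i, hij⟩⟩
      obtain ⟨g, hg⟩ := ih s s.lt_succ_self (merge_pos hν0 i j) (right_ne_zero_of_mul h)
      rw [sum_merge ν hij, card_ne] at hg
      have := i.pos
      exact ⟨g, by omega⟩
    · obtain ⟨i, -, h⟩ := Finset.exists_ne_zero_of_sum_ne_zero h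
      obtain ⟨⟨α, β⟩, hp, h⟩ := Finset.exists_ne_zero_of_sum_ne_zero (right_ne_zero_of_mul h)
      simp only [Finset.mem_filter, Finset.HasAntidiagonal.mem_antidiagonal] at hp
      obtain ⟨hαβ, hα, hβ⟩ := hp
      have := i.pos
      rcases ne_zero_or_ne_zero_of_add h with h | h
      · obtain ⟨g, hg⟩ := ih s s.lt_succ_self (split_pos hν0 i hα hβ) h
        rw [sum_split ν i hαβ, Fintype.card_option, Fintype.card_option, card_ne] at hg
        -- The cut removes one edge and adds one vertex, which lowers the genus by one.
        exact ⟨g + 1, by omega⟩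
      · obtain ⟨I, hI, h⟩ := Finset.exists_ne_zero_of_sum_ne_zero h
        obtain ⟨q, hq, h⟩ := Finset.exists_ne_zero_of_sum_ne_zero h
        rw [Finset.mem_powerset] at hI
        rw [Finset.HasAntidiagonal.mem_antidiagonal] at hq
        have h1 := left_ne_zero_of_mul (right_ne_zero_of_mul h)
        have h2 := right_ne_zero_of_mul (right_ne_zero_of_mul h)
        obtain ⟨g₁, hg₁⟩ := ih q.1 (by omega) (consOn_pos hν0 hα I) h1
        obtain ⟨g₂, hg₂⟩ := ih q.2 (by omega) (consOn_pos hν0 hβ _) h2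
        have hr₁ := dvd_of_numFactorizations_ne_zero h1
        rw [sum_consOn] at hr₁
        rw [sum_consOn, card_option_mem] at hg₁ hg₂
        have h3 := div_add_div_eq hr₁ (sum_consOn_add ν hαβ hI)
        simp only at h3 hg₁ hg₂
        have h4 := card_consOn_add hI
        exact ⟨g₁ + g₂, by omega⟩

end Support

/-! ### The recursion for weighted counts -/

section Weighted

variable {V : Type} [DecidableEq V]

/-- The number of factorizations with unordered pairs, divided by the number of orderings of the
transpositions. -/
noncomputable def weightedCount (r : ℕ) (μ : V → ℕ) (s : ℕ) : ℚ :=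
  numFactorizations r (stdPerm μ) s / (2 ^ s * s.factorial)

theorem count_eq_weightedCount {r g : ℕ} {μ : V → ℕ} [Fintype V] [Nonempty V] (hr : 0 < r)
    (hμ : ∀ v, 0 < μ v) : count r g μ = weightedCount r μ (numEdges r g μ) :=
  count_eq hr hμ

theorem weightedCount_eq_zero {r s : ℕ} {μ : V → ℕ}
    (h : numFactorizations r (stdPerm μ) s = 0) : weightedCount r μ s = 0 := by
  simp [weightedCount, h]

variable {n : ℕ} {μ : Fin n → ℕ}

/-- Both sides count factorizations beginning with a given pair, in its two orders; the order
affects neither the transposition nor the bridge. -/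
theorem weightedCount_merge_comm (hμ : ∀ v, 0 < μ v) (r : ℕ) {i j : Fin n} (hij : i ≠ j) (s : ℕ) :
    weightedCount r (merge μ i j) s = weightedCount r (merge μ j i) s := by
  have h : numBeginning r μ (lastDot hμ i) (lastDot hμ j) s =
      numBeginning r μ (lastDot hμ j) (lastDot hμ i) s := by
    have hset : ∀ l : List ((Σ v, Fin (μ v)) × (Σ v, Fin (μ v))), ∀ σ : Perm (Σ v, Fin (μ v)),
        ∀ a b, IsBridged r σ a b l → IsBridged r σ b a l := by
      rintro l σ a b ⟨h1, h2, h3⟩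
      refine ⟨h1, fun A hA hl => h2 A hA ?_, h3⟩
      simp only [List.mem_cons, forall_eq_or_imp] at hl ⊢
      exact ⟨hl.1.symm, hl.2⟩
    unfold numBeginning numBridged
    rw [swap_comm (lastDot hμ j)]
    simp only [eq_comm (a := lastDot hμ j)]
    congr 1
    exact Nat.card_congr (Equiv.subtypeEquivRight fun w => ⟨hset _ _ _ _, hset _ _ _ _⟩)
  unfold weightedCount
  rw [← numBeginning_eq_merge hμ r hij, ← numBeginning_eq_merge hμ r hij.symm, h]

theorem sum_sum_erase_eq {f : Fin n → Fin n → ℚ} (hf : ∀ i j, i ≠ j → f i j = f j i) :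
    ∑ i, ∑ j ∈ Finset.univ.erase i, f i j = 2 * ∑ i, ∑ j ∈ Finset.Ioi i, f i j := by
  have h1 : ∀ i : Fin n, ∑ j ∈ Finset.univ.erase i, f i j =
      ∑ j ∈ Finset.Iio i, f i j + ∑ j ∈ Finset.Ioi i, f i j := by
    intro i
    rw [← Finset.sum_union]
    · congr 1
      ext j
      simp only [Finset.mem_erase, Finset.mem_univ, and_true, Finset.mem_union, Finset.mem_Iio,
        Finset.mem_Ioi]
      exact ne_iff_lt_or_gt
    · rw [Finset.disjoint_left]
      intro j hj hj'
      exact lt_asymm (Finset.mem_Iio.1 hj) (Finset.mem_Ioi.1 hj')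
  simp only [h1, Finset.sum_add_distrib]
  have h2 : ∑ i, ∑ j ∈ Finset.Iio i, f i j = ∑ i, ∑ j ∈ Finset.Ioi i, f i j := by
    rw [Finset.sum_comm' (t' := Finset.univ) (s' := fun j => Finset.Ioi j) (by simp)]
    refine Finset.sum_congr rfl fun i _ => Finset.sum_congr rfl fun j hj => ?_
    exact hf _ _ (Finset.mem_Ioi.1 hj).ne'
  rw [h2]
  ring

/-- The cut-and-join recursion for the weighted counts. -/
theorem weighted_cut_and_join (hμ : ∀ v, 0 < μ v) (r s : ℕ) :
    ((s + 1 : ℕ) : ℚ) * weightedCount r μ (s + 1) =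
      (∑ i, ∑ j ∈ Finset.Ioi i, (μ i : ℚ) * μ j * weightedCount r (merge μ i j) s) +
      1 / 2 * ∑ i, (μ i : ℚ) * ∑ p ∈ (Finset.HasAntidiagonal.antidiagonal (μ i)).filter
          (fun p => 1 ≤ p.1 ∧ 1 ≤ p.2),
        (weightedCount r (split μ i p.1 p.2) s +
          ∑ I ∈ (Finset.univ.erase i).powerset, ∑ q ∈ Finset.HasAntidiagonal.antidiagonal s,
            weightedCount r (consOn p.1 μ I) q.1 *
              weightedCount r (consOn p.2 μ (Finset.univ.erase i \ I)) q.2) := by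
  have hD : (2 ^ s * s.factorial : ℚ) ≠ 0 := by positivity
  -- The binomial coefficient of the shuffles is what makes the normalized counts multiply.
  have hprod : ∀ q ∈ Finset.HasAntidiagonal.antidiagonal s, ∀ a b : ℕ,
      (a : ℚ) / (2 ^ q.1 * q.1.factorial) * (b / (2 ^ q.2 * q.2.factorial)) =
        (s.choose q.1 * (a * b) : ℕ) / (2 ^ s * s.factorial) := by
    intro q hq a b
    rw [Finset.HasAntidiagonal.mem_antidiagonal] at hq
    have h : ((s.choose q.1 : ℕ) : ℚ) * q.1.factorial * q.2.factorial = s.factorial := by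
      rw [← hq, Nat.choose_symm_add]
      exact_mod_cast Nat.add_choose_mul_factorial_mul_factorial q.1 q.2
    have h2 : (2 : ℚ) ^ s = 2 ^ q.1 * 2 ^ q.2 := by rw [← hq, pow_add]
    rw [div_mul_div_comm, div_eq_div_iff (by positivity) hD, h2, ← h]
    push_cast
    ring
  have h1 : ∑ i, ∑ j ∈ Finset.Ioi i, (μ i : ℚ) * μ j * weightedCount r (merge μ i j) s =
      1 / 2 * ∑ i, ∑ j ∈ Finset.univ.erase i,
        (μ i : ℚ) * μ j * weightedCount r (merge μ i j) s := by
    rw [sum_sum_erase_eq fun i j hij => by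
      rw [weightedCount_merge_comm hμ r hij, mul_comm (μ i : ℚ)]]
    ring
  rw [h1, ← mul_add]
  have h2 : ((s + 1 : ℕ) : ℚ) * weightedCount r μ (s + 1) =
      1 / 2 * (numFactorizations r (stdPerm μ) (s + 1) / (2 ^ s * s.factorial)) := by
    rw [weightedCount, Nat.factorial_succ, pow_succ]
    push_cast
    field_simp
  rw [h2, cut_and_join hμ]
  congr 1
  rw [Nat.cast_add, add_div]
  congr 1
  · rw [Nat.cast_sum, Finset.sum_div]
    refine Finset.sum_congr rfl fun i _ => ?_
    rw [Nat.cast_sum, Finset.sum_div]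
    refine Finset.sum_congr rfl fun j _ => ?_
    rw [weightedCount]
    push_cast
    ring
  · rw [Nat.cast_sum, Finset.sum_div]
    refine Finset.sum_congr rfl fun i _ => ?_
    rw [Nat.cast_mul, mul_div_assoc, Nat.cast_sum, Finset.sum_div]
    congr 1
    refine Finset.sum_congr rfl fun p _ => ?_
    rw [Nat.cast_add, add_div, weightedCount, Nat.cast_sum, Finset.sum_div]
    congr 1
    refine Finset.sum_congr rfl fun I _ => ?_
    rw [Nat.cast_sum, Finset.sum_div]
    exact Finset.sum_congr rfl fun q hq => (hprod q hq _ _).symm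

end Weighted

/-! ### From numbers of edges to genera -/

section Count

variable {n r : ℕ} {μ : Fin n → ℕ}

theorem count_eq_zero_of_not_dvd {V : Type} [Fintype V] [DecidableEq V] [Nonempty V] {μ : V → ℕ}
    (hr : 0 < r) (hμ : ∀ v, 0 < μ v) (h : ¬ r ∣ ∑ v, μ v) (g : ℕ) : count r g μ = 0 := by
  rw [count_eq_weightedCount hr hμ]
  refine weightedCount_eq_zero ?_
  by_contra h'
  exact h (dvd_of_numFactorizations_ne_zero h')

/-- The sum over the splittings of the genus is a sum over the splittings of the set of edges. -/
theorem sum_count_mul_count (hr : 0 < r) (hμ : ∀ v, 0 < μ v) {i : Fin n} {α β : ℕ} (hα : 0 < α)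
    (hβ : 0 < β) (hαβ : α + β = μ i) {I : Finset (Fin n)} (hI : I ⊆ Finset.univ.erase i)
    {g t : ℕ} (ht : t + 3 = 2 * g + (∑ k, μ k) / r + n) :
    ∑ q ∈ Finset.HasAntidiagonal.antidiagonal g, count r q.1 (consOn α μ I) *
        count r q.2 (consOn β μ (Finset.univ.erase i \ I)) =
      ∑ q ∈ Finset.HasAntidiagonal.antidiagonal t, weightedCount r (consOn α μ I) q.1 *
        weightedCount r (consOn β μ (Finset.univ.erase i \ I)) q.2 := by
  by_cases hdvd : r ∣ ∑ k, consOn α μ I k ∧ r ∣ ∑ k, consOn β μ (Finset.univ.erase i \ I) k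
  · obtain ⟨hd₁, hd₂⟩ := hdvd
    have hp₁ : 0 < (∑ k, consOn α μ I k) / r := Nat.div_pos (Nat.le_of_dvd
      (Finset.sum_pos (fun v _ => consOn_pos hμ hα I v) Finset.univ_nonempty) hd₁) hr
    have hp₂ : 0 < (∑ k, consOn β μ (Finset.univ.erase i \ I) k) / r := Nat.div_pos (Nat.le_of_dvd
      (Finset.sum_pos (fun v _ => consOn_pos hμ hβ _ v) Finset.univ_nonempty) hd₂) hr
    have hcard := card_consOn_add hI
    have hadd : (∑ k, consOn α μ I k) / r + (∑ k, consOn β μ (Finset.univ.erase i \ I) k) / r =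
        (∑ k, μ k) / r := by
      refine div_add_div_eq hd₁ ?_
      rw [sum_consOn, sum_consOn]
      exact sum_consOn_add μ hαβ hI
    refine Finset.sum_of_injOn (fun q => (numEdges r q.1 (consOn α μ I),
      numEdges r q.2 (consOn β μ (Finset.univ.erase i \ I)))) ?_ ?_ ?_ ?_
    · rintro q - q' - h
      simp only [Prod.mk.injEq, numEdges, card_option_mem] at h
      exact Prod.ext (by omega) (by omega)
    · intro q hq
      simp only [Finset.mem_coe, Finset.HasAntidiagonal.mem_antidiagonal, numEdges,
        card_option_mem] at hq ⊢
      omega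
    -- If both factors are nonzero, the Riemann-Hurwitz formula supplies genera for them, and these
    -- add up to `g`; pairs of numbers of edges outside the image therefore contribute nothing.
    · intro q hq hq'
      by_contra hne
      have h1 : numFactorizations r (stdPerm (consOn α μ I)) q.1 ≠ 0 := fun h =>
        left_ne_zero_of_mul hne (weightedCount_eq_zero h)
      have h2 : numFactorizations r (stdPerm (consOn β μ (Finset.univ.erase i \ I))) q.2 ≠ 0 :=
        fun h => right_ne_zero_of_mul hne (weightedCount_eq_zero h)
      obtain ⟨g₁, hg₁⟩ := exists_genus hr (consOn_pos hμ hα I) h1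
      obtain ⟨g₂, hg₂⟩ := exists_genus hr (consOn_pos hμ hβ _) h2
      rw [card_option_mem] at hg₁ hg₂
      rw [Finset.HasAntidiagonal.mem_antidiagonal] at hq
      refine hq' ⟨(g₁, g₂), ?_, ?_⟩
      · simp only [Finset.mem_coe, Finset.HasAntidiagonal.mem_antidiagonal]
        omega
      · simp only [numEdges, card_option_mem]
        exact Prod.ext (by simp only; omega) (by simp only; omega)
    · intro q _
      rw [count_eq_weightedCount hr (consOn_pos hμ hα I),
        count_eq_weightedCount hr (consOn_pos hμ hβ _)]
  · rw [Finset.sum_eq_zero, Finset.sum_eq_zero]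
    · intro q _
      by_contra hne
      exact hdvd ⟨dvd_of_numFactorizations_ne_zero fun h =>
          left_ne_zero_of_mul hne (weightedCount_eq_zero h),
        dvd_of_numFactorizations_ne_zero fun h =>
          right_ne_zero_of_mul hne (weightedCount_eq_zero h)⟩
    · intro q _
      by_contra hne
      refine hdvd ⟨?_, ?_⟩
      · by_contra h
        exact left_ne_zero_of_mul hne (count_eq_zero_of_not_dvd hr (consOn_pos hμ hα I) h _)
      · by_contra h
        exact right_ne_zero_of_mul hne (count_eq_zero_of_not_dvd hr (consOn_pos hμ hβ _) h _)

/-- A product of counts for two tuples vanishes unless there are enough dots for two faces. -/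
theorem count_mul_count_eq_zero (hr : 0 < r) (hμ : ∀ v, 0 < μ v) {i : Fin n} {α β : ℕ}
    (hα : 0 < α) (hβ : 0 < β) (hαβ : α + β = μ i) {I : Finset (Fin n)}
    (hI : I ⊆ Finset.univ.erase i) (h : ¬ (r ∣ ∑ k, μ k ∧ 2 ≤ (∑ k, μ k) / r)) (g₁ g₂ : ℕ) :
    count r g₁ (consOn α μ I) * count r g₂ (consOn β μ (Finset.univ.erase i \ I)) = 0 := by
  by_contra hne
  have hd₁ : r ∣ ∑ k, consOn α μ I k := by
    by_contra h
    exact left_ne_zero_of_mul hne (count_eq_zero_of_not_dvd hr (consOn_pos hμ hα I) h _)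
  have hd₂ : r ∣ ∑ k, consOn β μ (Finset.univ.erase i \ I) k := by
    by_contra h
    exact right_ne_zero_of_mul hne (count_eq_zero_of_not_dvd hr (consOn_pos hμ hβ _) h _)
  have hp₁ : 0 < (∑ k, consOn α μ I k) / r := Nat.div_pos (Nat.le_of_dvd
    (Finset.sum_pos (fun v _ => consOn_pos hμ hα I v) Finset.univ_nonempty) hd₁) hr
  have hp₂ : 0 < (∑ k, consOn β μ (Finset.univ.erase i \ I) k) / r := Nat.div_pos (Nat.le_of_dvd
    (Finset.sum_pos (fun v _ => consOn_pos hμ hβ _ v) Finset.univ_nonempty) hd₂) hr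
  have hsum : ∑ k, consOn α μ I k + ∑ k, consOn β μ (Finset.univ.erase i \ I) k = ∑ k, μ k := by
    rw [sum_consOn, sum_consOn]
    exact sum_consOn_add μ hαβ hI
  have hadd := div_add_div_eq hd₁ hsum
  exact h ⟨hsum ▸ dvd_add hd₁ hd₂, by omega⟩

end Count

end Hurwitz

/-! ### The edge-contraction formula -/

open Hurwitz in
theorem mainTheorem3 (r : ℕ) (hr : 0 < r) (g n : ℕ) (hn : 0 < n) (μ : Fin n → ℕ)
    (hμ : ∀ i, 0 < μ i) :
    (2 * (g : ℚ) - 2 + ((∑ i, μ i : ℕ) : ℚ) / (r : ℚ) + (n : ℚ)) * Hurwitz.count r g μ =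
      (∑ i : Fin n, ∑ j ∈ Finset.Ioi i,
        (μ i : ℚ) * (μ j : ℚ) * Hurwitz.count r g (Hurwitz.merge μ i j)) +
      1 / 2 * ∑ i : Fin n, (μ i : ℚ) *
        ∑ p ∈ (Finset.HasAntidiagonal.antidiagonal (μ i)).filter (fun p => 1 ≤ p.1 ∧ 1 ≤ p.2),
          ((if g = 0 then 0 else Hurwitz.count r (g - 1) (Hurwitz.split μ i p.1 p.2)) +
            ∑ q ∈ Finset.HasAntidiagonal.antidiagonal g, ∑ I ∈ (Finset.univ.erase i).powerset,
              Hurwitz.count r q.1 (Hurwitz.consOn p.1 μ I) *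
                Hurwitz.count r q.2 (Hurwitz.consOn p.2 μ (Finset.univ.erase i \ I))) := by
  have : Nonempty (Fin n) := ⟨⟨0, hn⟩⟩
  have hne : ∀ {i j : Fin n}, i ≠ j → Nonempty {k // k ≠ j} := fun {i j} h => ⟨⟨i, h⟩⟩
  have hdpos : 0 < ∑ i, μ i := Finset.sum_pos (fun v _ => hμ v) Finset.univ_nonempty
  by_cases hdvd : r ∣ ∑ i, μ i
  · have hcoef : 2 * (g : ℚ) - 2 + ((∑ i, μ i : ℕ) : ℚ) / (r : ℚ) + (n : ℚ) =
        (numEdges r g μ : ℚ) := by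
      have hk : 0 < (∑ i, μ i) / r := Nat.div_pos (Nat.le_of_dvd hdpos hdvd) hr
      have h : numEdges r g μ + 2 = 2 * g + (∑ i, μ i) / r + n := by
        rw [numEdges, Fintype.card_fin]
        omega
      have h' : (numEdges r g μ : ℚ) + 2 = 2 * g + ((∑ i, μ i) / r : ℕ) + n := by exact_mod_cast h
      rw [Nat.cast_div hdvd (by positivity)] at h'
      linarith
    rw [hcoef, count_eq_weightedCount hr hμ]
    have hk : 0 < (∑ i, μ i) / r := Nat.div_pos (Nat.le_of_dvd hdpos hdvd) hr
    rcases hs : numEdges r g μ with _ | t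
    -- No edges means `g = 0`, `n = 1` and a single face. There is nothing to join or to lower, and
    -- a product would need two faces.
    · rw [numEdges, Fintype.card_fin] at hs
      rw [Nat.cast_zero, zero_mul, Finset.sum_eq_zero, Finset.sum_eq_zero]
      · simp
      · intro i _
        rw [Finset.sum_eq_zero, mul_zero]
        intro p hp
        simp only [Finset.mem_filter, Finset.HasAntidiagonal.mem_antidiagonal] at hp
        rw [if_pos (by omega), zero_add]
        refine Finset.sum_eq_zero fun q _ => Finset.sum_eq_zero fun I hI => ?_
        exact count_mul_count_eq_zero hr hμ hp.2.1 hp.2.2 hp.1 (Finset.mem_powerset.1 hI)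
          (by omega) _ _
      · intro i _
        refine Finset.sum_eq_zero fun j hj => ?_
        rw [Finset.mem_Ioi] at hj
        have := j.2
        omega
    · rw [numEdges, Fintype.card_fin] at hs
      rw [weighted_cut_and_join hμ]
      congr 1
      · refine Finset.sum_congr rfl fun i _ => Finset.sum_congr rfl fun j hj => ?_
        have hij : i ≠ j := (Finset.mem_Ioi.1 hj).ne
        have := hne hij
        rw [count_eq_weightedCount hr (merge_pos hμ i j), numEdges, sum_merge μ hij, card_ne]
        congr 2
        omega
      · congr 1
        refine Finset.sum_congr rfl fun i _ => ?_
        congr 1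
        refine Finset.sum_congr rfl fun p hp => ?_
        simp only [Finset.mem_filter, Finset.HasAntidiagonal.mem_antidiagonal] at hp
        obtain ⟨hp, hp1, hp2⟩ := hp
        congr 1
        -- For `g = 0` the recursion still has a term for the split tuple, but the Riemann-Hurwitz
        -- formula would give it genus `-1`, so it vanishes.
        · split_ifs with hg
          · refine weightedCount_eq_zero ?_
            by_contra h
            obtain ⟨g', hg'⟩ := exists_genus hr (split_pos hμ i hp1 hp2) h
            rw [sum_split μ i hp, Fintype.card_option, Fintype.card_option, card_ne] at hg'
            omega
          · rw [count_eq_weightedCount hr (split_pos hμ i hp1 hp2), numEdges, sum_split μ i hp,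
              Fintype.card_option, Fintype.card_option, card_ne]
            congr 1
            omega
        · refine Eq.trans ?_ Finset.sum_comm
          refine Finset.sum_congr rfl fun I hI => ?_
          exact (sum_count_mul_count hr hμ hp1 hp2 hp (Finset.mem_powerset.1 hI) (by omega)).symm
  -- If `r` does not divide `d`, the coefficient on the left need not be `numEdges`, but all counts
  -- vanish: merging and splitting preserve `d`, and two factors divisible by `r` would have a sum
  -- divisible by `r`.
  · rw [count_eq_zero_of_not_dvd hr hμ hdvd, mul_zero, Finset.sum_eq_zero, Finset.sum_eq_zero]
    · simp
    · intro i _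
      rw [Finset.sum_eq_zero, mul_zero]
      intro p hp
      simp only [Finset.mem_filter, Finset.HasAntidiagonal.mem_antidiagonal] at hp
      rw [count_eq_zero_of_not_dvd hr (split_pos hμ i hp.2.1 hp.2.2)
        (by rwa [sum_split μ i hp.1]), ite_self, zero_add]
      refine Finset.sum_eq_zero fun q _ => Finset.sum_eq_zero fun I hI => ?_
      exact count_mul_count_eq_zero hr hμ hp.2.1 hp.2.2 hp.1 (Finset.mem_powerset.1 hI)
        (fun h => hdvd h.1) _ _
    · intro i _
      refine Finset.sum_eq_zero fun j hj => ?_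
      have hij : i ≠ j := (Finset.mem_Ioi.1 hj).ne
      have := hne hij
      rw [count_eq_zero_of_not_dvd hr (merge_pos hμ i j) (by rwa [sum_merge μ hij]), mul_zero]
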